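/- **Setting.** There are $n$ agents and a downward-closed family $\mathcal X$ of feasible subsets of $\{1,\dots,n\}$ in which every singleton $\{i\}$ is feasible. Agent $i$'s valuation $v_i\in[0,v_{\max}]$ is drawn independently from a distribution $F_i$, and $\mu_{\max}=\max_i \mathbf E[v_i]>0$. A (possibly randomized) algorithm $\mathcal A$ maps each valuation profile $v$ to a random feasible set. Its welfare is $\mathbf E[\sum_{i \text{ served}} v_i]$, and it is a *Bayesian $\beta$-approximation* ($\beta>0$) if its welfare is at least $\mathrm{OPT}/\beta$, where $\mathrm{OPT}=\mathbf E_v[\max_{S\in\mathcal X}\sum_{i\in S}v_i]$. Let $x_i(b)$ be the probability that agent $i$ is served when it reports $b$ and the other agents report valuations drawn from their distributions. The algorithm is *monotone* if every $x_i$ is non-decreasing on $[0,v_{\max}]$. It is *BIC* if there is a payment rule under which truthtelling is a Bayes–Nash equilibrium, i.e. with $p_i(b)$ the expected payment of agent $i$ when it reports $b$ and the others report truthfully, $t\,x_i(t)-p_i(t)\ge t\,x_i(b)-p_i(b)$ for all $i$ and all $t,b\in[0,v_{\max}]$. **Oracle model.** A reduction is a randomized program that is given $n,\varepsilon,v_{\max},\mu_{\max}$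 and the reported profile. It may adaptively call $\mathcal A$ on any profile, sample any $F_i$ conditioned on any interval $[a,b)$, and use random bits of its own; it has no other access to $\mathcal A$, the $F_i$ or $\mathcal X$. Its running time is the worst-case number of calls to $\mathcal A$. **Theorem.** There is such a reduction which, for every $n$, every $\varepsilon>0$ and every setting as above, turns every Bayesian $\beta$-approximation algorithm $\mathcal A$ (for every $\beta$) into an algorithm $\hat{\mathcal A}_\varepsilon$ that serves only feasible sets, is monotone and BIC, and is a Bayesian $\beta(1+\varepsilon)$-approximation. For $\varepsilon\le\frac12$ its running time is $$\tilde O\!\left(n^5\varepsilon^{-5}\log^3\frac{v_{\max}}{\varepsilon\mu_{\max}}\right),$$ that is, at most $C\,f\log^d f$ with absolute constants $C,d$ and $f=n^5\varepsilon^{-5}\log^3(v_{\max}/(\varepsilon\mu_{\max}))$; for $\varepsilon>\frac12$ the same bound holds with $\varepsilon$ replaced by $\frac12$ in $f$. The number of calls to the distribution oracle is at most $n$ times this bound. -/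

import Mathlib

open MeasureTheory ProbabilityTheory

namespace OracleMechanism

/-! ## Settings, algorithms, welfare -/

/-- A (randomized) algorithm for `n` single-parameter agents: `prob v S` is the probability that
exactly the agents in `S` are served on the valuation profile `v`. -/
structure Algorithm (n : ℕ) where
  prob : (Fin n → ℝ) → Finset (Fin n) → ℝ
  nonneg : ∀ v S, 0 ≤ prob v S
  sum_eq_one : ∀ v, ∑ S, prob v S = 1
  measurable : ∀ S, Measurable fun v => prob v S

/-- Any subset of a feasible set is feasible. -/
def IsDownwardClosed {n : ℕ} (feasible : Finset (Finset (Fin n))) : Prop :=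
  ∀ S ∈ feasible, ∀ T ⊆ S, T ∈ feasible

/-- The largest expected valuation of an agent. -/
noncomputable def maxMean {n : ℕ} (F : Fin n → Measure ℝ) : ℝ := ⨆ i, ∫ x, x ∂(F i)

/-- The expected optimal welfare, for valuations drawn from the product distribution. -/
noncomputable def expectedOpt {n : ℕ} (feasible : Finset (Finset (Fin n)))
    (F : Fin n → Measure ℝ) : ℝ :=
  ∫ v, (⨆ S : feasible, ∑ i ∈ S.1, v i) ∂(Measure.pi F)

namespace Algorithm

variable {n : ℕ} (A : Algorithm n)

/-- Only feasible sets are ever served (an infeasible set has infinite cost). -/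
def IsFeasible (feasible : Finset (Finset (Fin n))) : Prop :=
  ∀ v, ∀ S ∉ feasible, A.prob v S = 0

/-- The expected welfare of the algorithm. Feasible sets have cost zero, so for a feasible algorithm
this is the expected total valuation of the served agents. -/
noncomputable def welfare (F : Fin n → Measure ℝ) : ℝ :=
  ∫ v, (∑ S, A.prob v S * ∑ i ∈ S, v i) ∂(Measure.pi F)

/-- Bayesian `β`-approximation: the expected welfare is at least a `1 / β` fraction of the expected
optimal welfare. -/
def IsBayesianApprox (feasible : Finset (Finset (Fin n))) (F : Fin n → Measure ℝ) (β : ℝ) : Prop :=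
  A.IsFeasible feasible ∧ expectedOpt feasible F / β ≤ A.welfare F

/-- The probability that agent `i` is served when it reports `b`, the other agents report
truthfully, and their valuations are drawn from the product distribution. -/
noncomputable def interim (F : Fin n → Measure ℝ) (i : Fin n) (b : ℝ) : ℝ :=
  ∫ v, (∑ S with i ∈ S, A.prob (Function.update v i b) S) ∂(Measure.pi F)

/-- The probability of being served is non-decreasing in the own report. -/
def IsMonotone (F : Fin n → Measure ℝ) (vmax : ℝ) : Prop :=
  ∀ i, MonotoneOn (A.interim F i) (Set.Icc 0 vmax)

/-- Bayesian incentive compatibility: there is a payment rule (`p v i` is what agent `i` pays on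
average on the profile `v`) with which truthtelling is a Bayes-Nash equilibrium: for every true
value `t` and every report `b`, if the other agents tell the truth then reporting `t` gives an
expected utility at least as large as reporting `b`. -/
def IsBIC (F : Fin n → Measure ℝ) (vmax : ℝ) : Prop :=
  ∃ p : (Fin n → ℝ) → Fin n → ℝ,
    (∀ i, ∀ b ∈ Set.Icc 0 vmax,
      Integrable (fun v => p (Function.update v i b) i) (Measure.pi F)) ∧
    ∀ i, ∀ t ∈ Set.Icc 0 vmax, ∀ b ∈ Set.Icc 0 vmax,
      t * A.interim F i b - ∫ v, p (Function.update v i b) i ∂(Measure.pi F) ≤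
        t * A.interim F i t - ∫ v, p (Function.update v i t) i ∂(Measure.pi F)

end Algorithm

/-! ## The oracle model -/

/-- The answer to a sampling query: a draw from `μ` conditioned on the interval `[a, b)`. On an
interval of probability zero, where conditioning makes no sense, the answer is `a`. -/
noncomputable def sampleLaw (μ : Measure ℝ) (a b : ℝ) : Measure ℝ :=
  open Classical in if μ (Set.Ico a b) = 0 then Measure.dirac a else μ[|Set.Ico a b]

/-- Programs in the oracle model, for `n` agents, with `m` real registers in use. A program may
* stop and serve a set;
* call the algorithm oracle on any profile computed from the registers, and go on according to the
  answer;
* sample agent `i`'s value conditioned on any interval `[a, b)`, and store it in a new register;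
* store a uniform random number from `[0, 1]` in a new register;
* test the registers, and go on according to the outcome. -/
inductive OracleProgram (n : ℕ) : ℕ → Type
  | serve {m : ℕ} (S : Finset (Fin n)) : OracleProgram n m
  | callAlg {m : ℕ} (v : (Fin m → ℝ) → Fin n → ℝ) (hv : Measurable v)
      (k : Finset (Fin n) → OracleProgram n m) : OracleProgram n m
  | sample {m : ℕ} (i : Fin n) (a b : (Fin m → ℝ) → ℝ) (ha : Measurable a) (hb : Measurable b)
      (k : OracleProgram n (m + 1)) : OracleProgram n m
  | random {m : ℕ} (k : OracleProgram n (m + 1)) : OracleProgram n m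
  | test {m : ℕ} (c : Set (Fin m → ℝ)) (hc : MeasurableSet c)
      (yes no : OracleProgram n m) : OracleProgram n m

namespace OracleProgram

variable {n : ℕ}

/-- The largest possible number of calls to the algorithm oracle. -/
def algCalls : {m : ℕ} → OracleProgram n m → ℕ
  | _, serve _ => 0
  | _, callAlg _ _ k => 1 + Finset.univ.sup fun S => (k S).algCalls
  | _, sample _ _ _ _ _ k => k.algCalls
  | _, random k => k.algCalls
  | _, test _ _ yes no => max yes.algCalls no.algCalls

/-- The largest possible number of calls to the distribution oracle. -/
def distCalls : {m : ℕ} → OracleProgram n m → ℕ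
  | _, serve _ => 0
  | _, callAlg _ _ k => Finset.univ.sup fun S => (k S).distCalls
  | _, sample _ _ _ _ _ k => 1 + k.distCalls
  | _, random k => k.distCalls
  | _, test _ _ yes no => max yes.distCalls no.distCalls

/-- `P.outProb F A r S` is the probability that the program `P`, started with register contents `r`,
serves `S`, when the distribution oracle is that of `F` and the algorithm oracle is `A`. All answers
use fresh randomness. -/
noncomputable def outProb (F : Fin n → Measure ℝ) (A : Algorithm n) :
    {m : ℕ} → OracleProgram n m → (Fin m → ℝ) → Finset (Fin n) → ℝ
  | _, serve T, _, S => if T = S then 1 else 0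
  | _, callAlg v _ k, r, S => ∑ T, A.prob (v r) T * (k T).outProb F A r S
  | _, sample i a b _ _ k, r, S =>
      ∫ x, k.outProb F A (Fin.snoc r x) S ∂(sampleLaw (F i) (a r) (b r))
  | _, random k, r, S => ∫ x in Set.Icc (0 : ℝ) 1, k.outProb F A (Fin.snoc r x) S
  | _, test c _ yes no, r, S =>
      open Classical in if r ∈ c then yes.outProb F A r S else no.outProb F A r S

end OracleProgram

/-! ## The output of a program is again an algorithm -/

instance isProbabilityMeasure_sampleLaw (μ : Measure ℝ) [IsProbabilityMeasure μ] (a b : ℝ) :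
    IsProbabilityMeasure (sampleLaw μ a b) := by
  unfold sampleLaw
  split_ifs with h
  · infer_instance
  · exact cond_isProbabilityMeasure h

theorem measurable_snoc {m : ℕ} :
    Measurable fun p : (Fin m → ℝ) × ℝ => (Fin.snoc p.1 p.2 : Fin (m + 1) → ℝ) := by
  refine measurable_pi_iff.2 fun j => ?_
  refine Fin.lastCases ?_ (fun j => ?_) j
  · simpa using measurable_snd
  · simpa [Function.comp_def] using (measurable_pi_apply j).comp (measurable_fst (β := ℝ))

theorem integrable_of_unit {α : Type*} [MeasurableSpace α] {μ : Measure α} [IsFiniteMeasure μ]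
    {f : α → ℝ} (hf : Measurable f) (h0 : ∀ x, 0 ≤ f x) (h1 : ∀ x, f x ≤ 1) : Integrable f μ :=
  Integrable.of_bound hf.aestronglyMeasurable 1
    (Filter.Eventually.of_forall fun x => by
      rw [Real.norm_eq_abs, abs_of_nonneg (h0 x)]; exact h1 x)

theorem measurable_integral_sampleLaw {α : Type*} [MeasurableSpace α] (μ : Measure ℝ)
    [IsProbabilityMeasure μ] {a b : α → ℝ} (ha : Measurable a) (hb : Measurable b)
    {g : α × ℝ → ℝ} (hg : Measurable g) :
    Measurable fun r => ∫ x, g (r, x) ∂(sampleLaw μ (a r) (b r)) := by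
  classical
  have hs : MeasurableSet {p : α × ℝ | p.2 ∈ Set.Ico (a p.1) (b p.1)} := by
    have h1 : MeasurableSet {p : α × ℝ | a p.1 ≤ p.2} :=
      measurableSet_le (ha.comp measurable_fst) measurable_snd
    have h2 : MeasurableSet {p : α × ℝ | p.2 < b p.1} :=
      measurableSet_lt measurable_snd (hb.comp measurable_fst)
    exact h1.inter h2
  have hm : Measurable fun r => μ (Set.Ico (a r) (b r)) := measurable_measure_prodMk_left hs
  have hi : Measurable fun r => ∫ x in Set.Ico (a r) (b r), g (r, x) ∂μ := by
    have := ((hg.indicator hs).stronglyMeasurable.integral_prod_right' (ν := μ)).measurable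
    convert this using 1
    funext r
    rw [← integral_indicator measurableSet_Ico]
    rfl
  have hc : MeasurableSet {r | μ (Set.Ico (a r) (b r)) = 0} := hm (measurableSet_singleton 0)
  have key : Measurable fun r => if μ (Set.Ico (a r) (b r)) = 0 then g (r, a r) else
      ((μ (Set.Ico (a r) (b r)))⁻¹).toReal * ∫ x in Set.Ico (a r) (b r), g (r, x) ∂μ :=
    Measurable.ite hc (hg.comp (measurable_id.prodMk ha)) ((hm.inv.ennreal_toReal).mul hi)
  convert key using 1
  funext r
  by_cases h : μ (Set.Ico (a r) (b r)) = 0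
  · simp [sampleLaw, h]
  · simp [sampleLaw, h, ProbabilityTheory.cond, integral_smul_measure]

namespace OracleProgram

variable {n : ℕ} (F : Fin n → Measure ℝ) [∀ i, IsProbabilityMeasure (F i)] (A : Algorithm n)

theorem outProb_spec {m : ℕ} (P : OracleProgram n m) :
    (∀ r S, 0 ≤ P.outProb F A r S) ∧ (∀ r, ∑ S, P.outProb F A r S = 1) ∧
      ∀ S, Measurable fun r => P.outProb F A r S := by
  classical
  induction P with
  | serve T =>
    refine ⟨fun r S => ?_, fun r => ?_, fun S => ?_⟩
    · simp only [outProb]; split_ifs <;> norm_num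
    · simp [outProb]
    · simp only [outProb]; exact measurable_const
  | callAlg v hv k ih =>
    refine ⟨fun r S => ?_, fun r => ?_, fun S => ?_⟩
    · simp only [outProb]
      exact Finset.sum_nonneg fun T _ => mul_nonneg (A.nonneg _ _) ((ih T).1 _ _)
    · simp only [outProb]
      rw [Finset.sum_comm]
      simp only [← Finset.mul_sum, (ih _).2.1, mul_one, A.sum_eq_one]
    · simp only [outProb]
      exact Finset.measurable_sum _ fun T _ => ((A.measurable T).comp hv).mul ((ih T).2.2 S)
  | sample i a b ha hb k ih =>
    have hle : ∀ r S, k.outProb F A r S ≤ 1 := fun r S => by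
      rw [← ih.2.1 r]; exact Finset.single_le_sum (fun T _ => ih.1 r T) (Finset.mem_univ S)
    have hms : ∀ S, Measurable fun p : (Fin _ → ℝ) × ℝ => k.outProb F A (Fin.snoc p.1 p.2) S :=
      fun S => (ih.2.2 S).comp measurable_snoc
    refine ⟨fun r S => ?_, fun r => ?_, fun S => ?_⟩
    · simp only [outProb]
      exact integral_nonneg fun x => ih.1 _ _
    · simp only [outProb]
      rw [← integral_finsetSum]
      · simp [ih.2.1]
      · exact fun S _ => integrable_of_unit ((hms S).comp measurable_prodMk_left)
          (fun x => ih.1 _ _) (fun x => hle _ _)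
    · simp only [outProb]
      exact measurable_integral_sampleLaw (F i) ha hb (hms S)
  | random k ih =>
    have hle : ∀ r S, k.outProb F A r S ≤ 1 := fun r S => by
      rw [← ih.2.1 r]; exact Finset.single_le_sum (fun T _ => ih.1 r T) (Finset.mem_univ S)
    have hms : ∀ S, Measurable fun p : (Fin _ → ℝ) × ℝ => k.outProb F A (Fin.snoc p.1 p.2) S :=
      fun S => (ih.2.2 S).comp measurable_snoc
    refine ⟨fun r S => ?_, fun r => ?_, fun S => ?_⟩
    · simp only [outProb]
      exact integral_nonneg fun x => ih.1 _ _
    · simp only [outProb]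
      rw [← integral_finsetSum]
      · simp [ih.2.1]
      · exact fun S _ => integrable_of_unit ((hms S).comp measurable_prodMk_left)
          (fun x => ih.1 _ _) (fun x => hle _ _)
    · simp only [outProb]
      exact ((hms S).stronglyMeasurable.integral_prod_right'
        (ν := volume.restrict (Set.Icc (0 : ℝ) 1))).measurable
  | test c hc yes no ih1 ih2 =>
    refine ⟨fun r S => ?_, fun r => ?_, fun S => ?_⟩
    · simp only [outProb]; split_ifs
      · exact ih1.1 _ _
      · exact ih2.1 _ _
    · simp only [outProb]
      by_cases h : r ∈ c
      · simp [h, ih1.2.1]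
      · simp [h, ih2.2.1]
    · simp only [outProb]
      exact Measurable.ite hc (ih1.2.2 S) (ih2.2.2 S)

/-- The algorithm computed by a program whose input registers hold the reported profile. -/
noncomputable def toAlgorithm (P : OracleProgram n n) : Algorithm n where
  prob v S := P.outProb F A v S
  nonneg := (P.outProb_spec F A).1
  sum_eq_one := (P.outProb_spec F A).2.1
  measurable := (P.outProb_spec F A).2.2

end OracleProgram

/-- The quantity `n⁵ ε⁻⁵ log³ (v_max / (ε μ_max))`. -/
noncomputable def runtimeScale (n : ℕ) (ε vmax μmax : ℝ) : ℝ :=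
  (n : ℝ) ^ 5 * (ε ^ 5)⁻¹ * Real.log (vmax / (ε * μmax)) ^ 3

end OracleMechanism

open OracleMechanism

/-! Divide `[0, vmax]` into `K` cells by a geometric grid with ratio `1 + e / 4`. For each agent,
pool adjacent cells until the probability of being served, conditional on the block holding the
agent's value, is increasing. Then replace every reported value by a fresh draw from its block, and
call `A` on the result. Redrawing within the blocks of a partition leaves each `F j` unchanged
(`bind_blockLaw`). From agent `i`'s viewpoint the opponents are therefore distributed as before, and
its new interim probability is the average of the old one over its block
(`interim_ironed_of_isIroned`). This decouples the agents.

The cost to welfare is small. If an upper block is served less often than the block below it,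
merging them loses nothing, as values and service probabilities are then oppositely sorted
(`merge_le_aux`). Coarsening to cells costs a factor `1 + e / 4`, except on the first cell, where at
most its length is lost (`le_sum_cells`).

Block probabilities can only be estimated. Each block, merged ones included, gets its own `s` calls,
so no probabilities of cells under `F i` are needed, and counts can be compared directly. A
potential argument gives at most `2 * K` estimates per agent. A Chernoff bound makes each accurate
to `η` except with probability `p`, whatever the earlier answers were (`le_expect_of_ensures`).
Monotonicity then holds only up to `2 * η + 2 * n * K * p`, averaged over the estimates, while each
merge may lose `2 * η` times the agent's mean value.

A lottery repairs both defects. With small probability `w` per agent it serves that agent alone,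
with chance `1 / 2 + level / (2 * K)`. The second term rises by `1 / (2 * K)` per cell and outweighs
the error in monotonicity; inside a cell there is no error, because the mechanism sees the report
only through its cell (`interim_reduction_mono`). The term `1 / 2` yields welfare proportional to
`w` times the sum of the mean values, which absorbs all additive losses, so no comparison of OPT
with the means is required (`welfare_le_welfare_reduction`). Exact monotonicity gives BIC by
Myerson's payments.

For the running time, `K` is about `L / e`, where `L` is the logarithm of `vmax / (e * μ)`, and `1 /
η` is about `n * K / e`. Hence `n * K * s` is about `n³ e⁻² K³ = n³ e⁻⁵ L³` up to logarithmic
factors, within the claimed bound. -/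

namespace OracleMechanism

/-! ## Product measures -/

theorem isProbabilityMeasure_update {n : ℕ} (F : Fin n → Measure ℝ)
    [∀ i, IsProbabilityMeasure (F i)] (i : Fin n) (ν : Measure ℝ) [IsProbabilityMeasure ν]
    (j : Fin n) : IsProbabilityMeasure (Function.update F i ν j) := by
  by_cases h : j = i
  · subst h; simpa
  · simpa [h] using ‹∀ i, IsProbabilityMeasure (F i)› j

theorem measurable_measure_pi {n : ℕ} {α : Type*} [MeasurableSpace α] {κ : Fin n → α → Measure ℝ}
    [∀ j x, IsProbabilityMeasure (κ j x)] (h : ∀ j, Measurable (κ j)) :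
    Measurable fun x => Measure.pi fun j => κ j x := by
  refine Measurable.measure_of_isPiSystem_of_isProbabilityMeasure generateFrom_pi.symm
    isPiSystem_pi ?_
  rintro _ ⟨s, hs, rfl⟩
  simp only [Measure.pi_pi]
  exact Finset.measurable_prod _ fun j _ =>
    (Measure.measurable_coe (show MeasurableSet (s j) from hs j (Set.mem_univ j))).comp (h j)

/-- The measures agree on boxes, because the integral of a product of functions of independent
coordinates factors. -/
theorem pi_bind {n : ℕ} (ν : Fin n → Measure ℝ) [∀ j, IsProbabilityMeasure (ν j)]
    (κ : Fin n → ℝ → Measure ℝ) [∀ j x, IsProbabilityMeasure (κ j x)] (h : ∀ j, Measurable (κ j)) :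
    (Measure.pi ν).bind (fun v => Measure.pi fun j => κ j (v j)) =
      Measure.pi fun j => (ν j).bind (κ j) := by
  have hκ : Measurable fun v : Fin n → ℝ => Measure.pi fun j => κ j (v j) :=
    measurable_measure_pi (κ := fun j (v : Fin n → ℝ) => κ j (v j)) fun j =>
      (h j).comp (measurable_pi_apply j)
  have (j : Fin n) : IsProbabilityMeasure ((ν j).bind (κ j)) := by
    constructor
    rw [Measure.bind_apply MeasurableSet.univ (h j).aemeasurable]
    simp
  refine (Measure.pi_eq fun s hs => ?_).symm
  rw [Measure.bind_apply (MeasurableSet.univ_pi hs) hκ.aemeasurable]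
  simp only [Measure.pi_pi]
  have hm (j : Fin n) : Measurable fun x => κ j x (s j) := (Measure.measurable_coe (hs j)).comp (h j)
  rw [lintegral_prod_eq_prod_lintegral_of_indepFun Finset.univ
    (fun j (v : Fin n → ℝ) => κ j (v j) (s j))
    (iIndepFun_pi (X := fun j x => κ j x (s j)) fun j => (hm j).aemeasurable)
    fun j => (hm j).comp (measurable_pi_apply j)]
  refine Finset.prod_congr rfl fun j _ => ?_
  rw [Measure.bind_apply (hs j) (h j).aemeasurable]
  exact (measurePreserving_eval ν j).lintegral_comp (hm j)

theorem integral_pi_bind {n : ℕ} (ν : Fin n → Measure ℝ) [∀ j, IsProbabilityMeasure (ν j)]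
    (κ : Fin n → ℝ → Measure ℝ) [∀ j x, IsProbabilityMeasure (κ j x)] (h : ∀ j, Measurable (κ j))
    {φ : (Fin n → ℝ) → ℝ} (hφ : Measurable φ) (h0 : ∀ v, 0 ≤ φ v) (h1 : ∀ v, φ v ≤ 1) :
    ∫ v, ∫ w, φ w ∂(Measure.pi fun j => κ j (v j)) ∂(Measure.pi ν) =
      ∫ w, φ w ∂(Measure.pi fun j => (ν j).bind (κ j)) := by
  have hκ : Measurable fun v : Fin n → ℝ => Measure.pi fun j => κ j (v j) :=
    measurable_measure_pi (κ := fun j (v : Fin n → ℝ) => κ j (v j)) fun j =>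
      (h j).comp (measurable_pi_apply j)
  have (j : Fin n) : IsProbabilityMeasure ((ν j).bind (κ j)) := by
    constructor
    rw [Measure.bind_apply MeasurableSet.univ (h j).aemeasurable]
    simp
  have e : (Kernel.mk _ hκ ∘ₖ Kernel.const Unit (Measure.pi ν)) () =
      Measure.pi fun j => (ν j).bind (κ j) := by
    rw [Kernel.comp_apply, Kernel.const_apply, ← pi_bind ν κ h]; rfl
  have := Kernel.integral_comp (η := Kernel.mk _ hκ) (κ := Kernel.const Unit (Measure.pi ν))
    (a := ()) (f := φ) (by rw [e]; exact integrable_of_unit hφ h0 h1)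
  rw [e] at this
  rw [this]; rfl

theorem measurable_update_prod {n : ℕ} (i : Fin n) :
    Measurable fun p : ℝ × (Fin n → ℝ) => Function.update p.2 i p.1 := by
  refine measurable_pi_iff.2 fun j => ?_
  by_cases h : j = i
  · subst h; simpa using measurable_fst
  · simpa [h, Function.comp_def] using
      (measurable_pi_apply (X := fun _ : Fin n => ℝ) j).comp (measurable_snd (α := ℝ))

/-- The overwritten coordinate is integrated out and contributes a factor `1` on every box. -/
theorem pi_update {n : ℕ} (F : Fin n → Measure ℝ) [∀ i, IsProbabilityMeasure (F i)] (i : Fin n)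
    (ν : Measure ℝ) [IsProbabilityMeasure ν] :
    Measure.pi (Function.update F i ν) =
      (ν.prod (Measure.pi F)).map fun p => Function.update p.2 i p.1 := by
  have := isProbabilityMeasure_update F i ν
  refine Measure.pi_eq fun s hs => ?_
  rw [Measure.map_apply (measurable_update_prod i) (MeasurableSet.univ_pi hs)]
  have : (fun p : ℝ × (Fin n → ℝ) => Function.update p.2 i p.1) ⁻¹' Set.univ.pi s =
      s i ×ˢ Set.univ.pi (Function.update s i Set.univ) := by
    ext ⟨x, v⟩
    simp only [Set.mem_preimage, Set.mem_pi, Set.mem_univ, true_implies, Set.mem_prod]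
    constructor
    · intro h
      refine ⟨by simpa using h i, fun j => ?_⟩
      by_cases hj : j = i
      · subst hj; simp
      · simpa [hj] using h j
    · rintro ⟨h1, h2⟩ j
      by_cases hj : j = i
      · subst hj; simpa
      · simpa [hj] using h2 j
  rw [this, Measure.prod_prod, Measure.pi_pi, ← Finset.mul_prod_erase _ _ (Finset.mem_univ i),
    ← Finset.mul_prod_erase Finset.univ (fun j => Function.update F i ν j (s j))
      (Finset.mem_univ i)]
  simp only [Function.update_self, measure_univ, one_mul]
  congr 1
  refine Finset.prod_congr rfl fun j hj => ?_
  simp [Finset.ne_of_mem_erase hj]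

theorem integral_pi_update {n : ℕ} (F : Fin n → Measure ℝ) [∀ i, IsProbabilityMeasure (F i)]
    (i : Fin n) (ν : Measure ℝ) [IsProbabilityMeasure ν] {φ : (Fin n → ℝ) → ℝ}
    (hφ : Integrable φ (Measure.pi (Function.update F i ν))) :
    ∫ v, φ v ∂(Measure.pi (Function.update F i ν)) =
      ∫ x, ∫ v, φ (Function.update v i x) ∂(Measure.pi F) ∂ν := by
  rw [pi_update] at hφ ⊢
  rw [integral_map (measurable_update_prod i).aemeasurable hφ.aestronglyMeasurable]
  exact integral_prod (fun p => φ (Function.update p.2 i p.1))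
    (hφ.comp_measurable (measurable_update_prod i))

/-! ## Interim allocations -/

namespace Algorithm

variable {n : ℕ} (A : Algorithm n) (F : Fin n → Measure ℝ)

/-- The probability that agent `i` is served on the profile `v`. -/
noncomputable def servedProb (i : Fin n) (v : Fin n → ℝ) : ℝ := ∑ S with i ∈ S, A.prob v S

theorem measurable_servedProb (i : Fin n) : Measurable (A.servedProb i) :=
  Finset.measurable_sum _ fun S _ => A.measurable S

theorem servedProb_nonneg (i : Fin n) (v : Fin n → ℝ) : 0 ≤ A.servedProb i v :=
  Finset.sum_nonneg fun _ _ => A.nonneg _ _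

theorem servedProb_le_one (i : Fin n) (v : Fin n → ℝ) : A.servedProb i v ≤ 1 := by
  rw [← A.sum_eq_one v]
  exact Finset.sum_le_sum_of_subset_of_nonneg (Finset.filter_subset _ _) fun _ _ _ => A.nonneg _ _

theorem interim_eq (i : Fin n) (b : ℝ) :
    A.interim F i b = ∫ v, A.servedProb i (Function.update v i b) ∂(Measure.pi F) := rfl

theorem interim_nonneg (i : Fin n) (b : ℝ) : 0 ≤ A.interim F i b :=
  integral_nonneg fun _ => A.servedProb_nonneg _ _

variable [∀ i, IsProbabilityMeasure (F i)]

theorem measurable_interim (i : Fin n) : Measurable (A.interim F i) := by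
  have : Measurable fun p : ℝ × (Fin n → ℝ) => A.servedProb i (Function.update p.2 i p.1) :=
    (A.measurable_servedProb i).comp (measurable_update_prod i)
  exact (this.stronglyMeasurable.integral_prod_right' (ν := Measure.pi F)).measurable

theorem interim_le_one (i : Fin n) (b : ℝ) : A.interim F i b ≤ 1 := by
  rw [interim_eq]
  calc _ ≤ ∫ _, (1 : ℝ) ∂(Measure.pi F) := by
        refine integral_mono_of_nonneg (Filter.Eventually.of_forall fun _ =>
          A.servedProb_nonneg _ _) (integrable_const _) (Filter.Eventually.of_forall fun _ =>
          A.servedProb_le_one _ _)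
    _ = 1 := by simp

theorem integrable_interim (i : Fin n) (μ : Measure ℝ) [IsFiniteMeasure μ] :
    Integrable (A.interim F i) μ :=
  integrable_of_unit (A.measurable_interim F i) (A.interim_nonneg F i) (A.interim_le_one F i)

theorem integral_servedProb_pi_update (i : Fin n) (ν : Measure ℝ) [IsProbabilityMeasure ν] :
    ∫ v, A.servedProb i v ∂(Measure.pi (Function.update F i ν)) = ∫ x, A.interim F i x ∂ν := by
  have := isProbabilityMeasure_update F i ν
  exact integral_pi_update F i ν
    (integrable_of_unit (A.measurable_servedProb i) (A.servedProb_nonneg i) (A.servedProb_le_one i))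

theorem integrable_mul_interim {i : Fin n} {μ : Measure ℝ} (h : Integrable (fun x => x) μ) :
    Integrable (fun x => x * A.interim F i x) μ :=
  h.mul_bdd (c := 1) (A.measurable_interim F i).aestronglyMeasurable
    (Filter.Eventually.of_forall fun x => by
      rw [Real.norm_eq_abs, abs_of_nonneg (A.interim_nonneg F i x)]; exact A.interim_le_one F i x)

/-- Welfare is additive over the agents, and each agent's share depends on its interim probability
only. This is what allows a separate welfare analysis for each agent. -/
theorem welfare_eq_sum_interim (hF : ∀ i, Integrable (fun x => x) (F i)) :
    A.welfare F = ∑ i, ∫ x, x * A.interim F i x ∂(F i) := by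
  have h1 (i : Fin n) : Integrable (fun v : Fin n → ℝ => v i * A.servedProb i v) (Measure.pi F) := by
    refine Integrable.mul_bdd (c := 1) ?_ (A.measurable_servedProb i).aestronglyMeasurable
      (Filter.Eventually.of_forall fun x => by
        rw [Real.norm_eq_abs, abs_of_nonneg (A.servedProb_nonneg i x)]
        exact A.servedProb_le_one i x)
    exact integrable_comp_eval (μ := F) (f := fun x => x) (hF i)
  have h2 (v : Fin n → ℝ) : ∑ S, A.prob v S * ∑ i ∈ S, v i = ∑ i, v i * A.servedProb i v := by
    simp only [servedProb, Finset.mul_sum, Finset.sum_filter]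
    rw [Finset.sum_comm (s := Finset.univ) (t := Finset.univ)]
    refine Finset.sum_congr rfl fun S _ => ?_
    simp [mul_comm]
  rw [welfare]
  simp only [h2]
  rw [integral_finsetSum _ fun i _ => h1 i]
  refine Finset.sum_congr rfl fun i _ => ?_
  have := integral_pi_update F i (F i) (φ := fun v => v i * A.servedProb i v)
    (by simpa using h1 i)
  simp only [Function.update_eq_self, Function.update_self, integral_const_mul] at this
  exact this

end Algorithm

/-! ## Programs that depend on the reported profile only -/

/-- A program for every number of registers, given the registers that hold the reported profile. -/
abbrev InputProgram (n : ℕ) : Type := ∀ m : ℕ, (Fin n → Fin m) → OracleProgram n m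

namespace OracleProgram

variable {n m : ℕ}

/-- Sample the values of the first `j` agents, each conditioned on its interval `[a i, b i)`. -/
def sampleCoords (a b : Fin n → (Fin m → ℝ) → ℝ) (ha : ∀ i, Measurable (a i))
    (hb : ∀ i, Measurable (b i)) : (j : ℕ) → j ≤ n → OracleProgram n (m + j) → OracleProgram n m
  | 0, _, P => P
  | j + 1, hj, P => sampleCoords a b ha hb j (Nat.le_of_succ_le hj)
      (.sample ⟨j, hj⟩ (fun r => a ⟨j, hj⟩ fun k => r (Fin.castAdd j k))
        (fun r => b ⟨j, hj⟩ fun k => r (Fin.castAdd j k))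
        ((ha _).comp (measurable_pi_iff.2 fun k => measurable_pi_apply (Fin.castAdd j k)))
        ((hb _).comp (measurable_pi_iff.2 fun k => measurable_pi_apply (Fin.castAdd j k))) P)

variable {a b : Fin n → (Fin m → ℝ) → ℝ} {ha : ∀ i, Measurable (a i)} {hb : ∀ i, Measurable (b i)}

theorem algCalls_sampleCoords (j : ℕ) (hj : j ≤ n) (P : OracleProgram n (m + j)) :
    (sampleCoords a b ha hb j hj P).algCalls = P.algCalls := by
  induction j with
  | zero => rfl
  | succ j ih => rw [sampleCoords, ih]; rfl

theorem distCalls_sampleCoords (j : ℕ) (hj : j ≤ n) (P : OracleProgram n (m + j)) :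
    (sampleCoords a b ha hb j hj P).distCalls = j + P.distCalls := by
  induction j with
  | zero => simp [sampleCoords]
  | succ j ih => rw [sampleCoords, ih]; simp only [distCalls]; omega

variable (F : Fin n → Measure ℝ) [∀ i, IsProbabilityMeasure (F i)] (A : Algorithm n)

theorem outProb_nonneg (P : OracleProgram n m) (r : Fin m → ℝ) (S : Finset (Fin n)) :
    0 ≤ P.outProb F A r S := (P.outProb_spec F A).1 r S

theorem outProb_le_one (P : OracleProgram n m) (r : Fin m → ℝ) (S : Finset (Fin n)) :
    P.outProb F A r S ≤ 1 := by
  rw [← (P.outProb_spec F A).2.1 r]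
  exact Finset.single_le_sum (fun T _ => P.outProb_nonneg F A r T) (Finset.mem_univ S)

theorem measurable_outProb (P : OracleProgram n m) (S : Finset (Fin n)) :
    Measurable fun r => P.outProb F A r S := (P.outProb_spec F A).2.2 S

theorem measurable_append (r : Fin m → ℝ) (j : ℕ) :
    Measurable fun w : Fin j → ℝ => (Fin.append r w : Fin (m + j) → ℝ) := by
  refine measurable_pi_iff.2 fun k => ?_
  refine Fin.addCases (fun k => ?_) (fun k => ?_) k
  · simp
  · simpa using measurable_pi_apply k

/-- The interval endpoints read only the original `m` registers, so successive draws are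
independent. The last one is split off by Fubini. -/
theorem outProb_sampleCoords (r : Fin m → ℝ) (S : Finset (Fin n)) (j : ℕ) (hj : j ≤ n)
    (P : OracleProgram n (m + j)) :
    (sampleCoords a b ha hb j hj P).outProb F A r S =
      ∫ w, P.outProb F A (Fin.append r w) S ∂(Measure.pi fun i : Fin j =>
        sampleLaw (F (Fin.castLE hj i)) (a (Fin.castLE hj i) r) (b (Fin.castLE hj i) r)) := by
  induction j with
  | zero =>
    rw [Measure.pi_of_empty, integral_dirac]
    simp only [sampleCoords]
    congr 1
    funext k
    exact (Fin.append_left (n := 0) r _ k).symm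
  | succ j ih =>
    rw [sampleCoords, ih]
    set ν : Fin (j + 1) → Measure ℝ := fun i =>
      sampleLaw (F (Fin.castLE hj i)) (a (Fin.castLE hj i) r) (b (Fin.castLE hj i) r)
    have hν (i : Fin (j + 1)) : IsProbabilityMeasure (ν i) := isProbabilityMeasure_sampleLaw _ _ _
    have hmp := measurePreserving_piFinSuccAbove ν (Fin.last j)
    rw [← hmp.symm.integral_comp']
    have hint : Integrable (fun p : ℝ × (Fin j → ℝ) => P.outProb F A
        (Fin.append r ((MeasurableEquiv.piFinSuccAbove (fun _ => ℝ) (Fin.last j)).symm p)) S)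
        ((ν (Fin.last j)).prod (Measure.pi fun i => ν ((Fin.last j).succAbove i))) :=
      integrable_of_unit (((P.measurable_outProb F A S).comp (measurable_append r (j + 1))).comp
        (MeasurableEquiv.measurable _)) (fun _ => P.outProb_nonneg F A _ _)
        (fun _ => P.outProb_le_one F A _ _)
    rw [integral_prod_symm _ hint]
    simp only [Fin.succAbove_last, outProb]
    refine integral_congr_ae (Filter.Eventually.of_forall fun w => ?_)
    have h1 : (fun k => Fin.append r w (Fin.castAdd j k)) = r := by
      funext k; simp
    dsimp only
    rw [h1]
    refine integral_congr_ae (Filter.Eventually.of_forall fun x => ?_)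
    dsimp only
    congr 1
    have : (MeasurableEquiv.piFinSuccAbove (fun _ => ℝ) (Fin.last j)).symm (x, w) =
        (Fin.snoc w x : Fin (j + 1) → ℝ) := by
      simp [MeasurableEquiv.piFinSuccAbove, Fin.insertNthEquiv, Fin.insertNth_last']
    rw [this, Fin.append_snoc]

end OracleProgram

namespace InputProgram

variable {n : ℕ}

/-- The program serves `S` with probability `d v S` when the reported profile is `v`. -/
def Denotes (F : Fin n → Measure ℝ) (A : Algorithm n) (P : InputProgram n)
    (d : (Fin n → ℝ) → Finset (Fin n) → ℝ) : Prop :=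
  ∀ m (e : Fin n → Fin m) (r : Fin m → ℝ) S, (P m e).outProb F A r S = d (fun i => r (e i)) S

/-- At most `N` calls to the algorithm oracle, and at most `n * N` to the distribution oracle. -/
def CallsLE (P : InputProgram n) (N : ℕ) : Prop :=
  ∀ m (e : Fin n → Fin m), (P m e).algCalls ≤ N ∧ (P m e).distCalls ≤ n * N

/-- Serve a fixed set. -/
def serve (S : Finset (Fin n)) : InputProgram n := fun _ _ => .serve S

/-- Run `P` with probability `p v`, where `v` is the reported profile, and `Q` otherwise. -/
def coin (p : (Fin n → ℝ) → ℝ) (hp : Measurable p) (P Q : InputProgram n) : InputProgram n :=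
  fun m e => .random (.test {r | r (Fin.last m) < p fun i => r (e i).castSucc}
    (measurableSet_lt (measurable_pi_apply _)
      (hp.comp (measurable_pi_iff.2 fun _ => measurable_pi_apply _)))
    (P (m + 1) fun i => (e i).castSucc) (Q (m + 1) fun i => (e i).castSucc))

/-- Sample for each agent `i` a value conditioned on `[a i (v i), b i (v i))`, where `v` is the
reported profile, and call the algorithm oracle on the resulting profile. -/
def resampleCall (a b : Fin n → ℝ → ℝ) (ha : ∀ i, Measurable (a i)) (hb : ∀ i, Measurable (b i))
    (k : Finset (Fin n) → InputProgram n) : InputProgram n :=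
  fun m e => OracleProgram.sampleCoords (fun i r => a i (r (e i))) (fun i r => b i (r (e i)))
    (fun i => (ha i).comp (measurable_pi_apply _)) (fun i => (hb i).comp (measurable_pi_apply _))
    n le_rfl (.callAlg (fun r i => r (Fin.natAdd m i))
      (measurable_pi_iff.2 fun _ => measurable_pi_apply _)
      fun T => k T (m + n) fun i => Fin.castAdd n (e i))

theorem CallsLE.mono {P : InputProgram n} {M N : ℕ} (h : P.CallsLE M) (hMN : M ≤ N) :
    P.CallsLE N := fun m e =>
  ⟨(h m e).1.trans hMN, (h m e).2.trans (Nat.mul_le_mul_left _ hMN)⟩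

theorem callsLE_serve (S : Finset (Fin n)) (N : ℕ) : (serve S).CallsLE N := fun _ _ =>
  ⟨Nat.zero_le _, Nat.zero_le _⟩

theorem CallsLE.coin {p : (Fin n → ℝ) → ℝ} {hp : Measurable p} {P Q : InputProgram n} {N : ℕ}
    (hP : P.CallsLE N) (hQ : Q.CallsLE N) : (coin p hp P Q).CallsLE N := fun m e => by
  constructor
  · simp only [InputProgram.coin, OracleProgram.algCalls]
    exact max_le (hP _ _).1 (hQ _ _).1
  · simp only [InputProgram.coin, OracleProgram.distCalls]
    exact max_le (hP _ _).2 (hQ _ _).2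

theorem CallsLE.resampleCall {a b : Fin n → ℝ → ℝ} {ha : ∀ i, Measurable (a i)}
    {hb : ∀ i, Measurable (b i)} {k : Finset (Fin n) → InputProgram n} {N : ℕ}
    (hk : ∀ T, (k T).CallsLE N) : (resampleCall a b ha hb k).CallsLE (N + 1) := fun m e => by
  constructor
  · simp only [InputProgram.resampleCall, OracleProgram.algCalls_sampleCoords,
      OracleProgram.algCalls]
    rw [add_comm]
    exact Nat.add_le_add_right (Finset.sup_le fun T _ => (hk T _ _).1) 1
  · simp only [InputProgram.resampleCall, OracleProgram.distCalls_sampleCoords,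
      OracleProgram.distCalls]
    rw [Nat.mul_succ, add_comm]
    exact Nat.add_le_add_right (Finset.sup_le fun T _ => (hk T _ _).2) n

variable {F : Fin n → Measure ℝ} {A : Algorithm n}

theorem denotes_serve (T : Finset (Fin n)) :
    (serve T).Denotes F A fun _ S => if T = S then 1 else 0 := fun _ _ _ _ => rfl

theorem integral_indicator_lt {p : ℝ} (h0 : 0 ≤ p) (h1 : p ≤ 1) (a b : ℝ) :
    ∫ x in Set.Icc (0 : ℝ) 1, (if x < p then a else b) = p * a + (1 - p) * b := by
  have e : (fun x : ℝ => if x < p then a else b) =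
      fun x => (Set.Iio p).indicator (fun _ => a - b) x + b := by
    funext x
    by_cases h : x < p <;> simp [h]
  rw [e, integral_add ((integrable_const _).indicator measurableSet_Iio) (integrable_const _),
    integral_indicator measurableSet_Iio, Measure.restrict_restrict measurableSet_Iio]
  have : Set.Iio p ∩ Set.Icc (0 : ℝ) 1 = Set.Ico 0 p := by
    ext x; simp only [Set.mem_inter_iff, Set.mem_Iio, Set.mem_Icc, Set.mem_Ico]
    constructor
    · rintro ⟨h, h', _⟩; exact ⟨h', h⟩
    · rintro ⟨h, h'⟩; exact ⟨h', h, by linarith⟩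
  rw [this]
  simp [h0]
  ring

theorem Denotes.coin {p : (Fin n → ℝ) → ℝ} {hp : Measurable p} {P Q : InputProgram n}
    {c d : (Fin n → ℝ) → Finset (Fin n) → ℝ} (h0 : ∀ v, 0 ≤ p v) (h1 : ∀ v, p v ≤ 1)
    (hP : P.Denotes F A c) (hQ : Q.Denotes F A d) :
    (coin p hp P Q).Denotes F A fun v S => p v * c v S + (1 - p v) * d v S := fun m e r S => by
  simp only [InputProgram.coin, OracleProgram.outProb, hP _ _ _ _, hQ _ _ _ _, Set.mem_ofPred_eq,
    Fin.snoc_last, Fin.snoc_castSucc]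
  exact integral_indicator_lt (h0 _) (h1 _) _ _

theorem Denotes.resampleCall [∀ i, IsProbabilityMeasure (F i)] {a b : Fin n → ℝ → ℝ}
    {ha : ∀ i, Measurable (a i)} {hb : ∀ i, Measurable (b i)}
    {k : Finset (Fin n) → InputProgram n} {d : Finset (Fin n) → (Fin n → ℝ) → Finset (Fin n) → ℝ}
    (hk : ∀ T, (k T).Denotes F A (d T)) :
    (resampleCall a b ha hb k).Denotes F A fun v S => ∫ w, ∑ T, A.prob w T * d T v S
      ∂(Measure.pi fun j => sampleLaw (F j) (a j (v j)) (b j (v j))) := fun m e r S => by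
  rw [InputProgram.resampleCall, OracleProgram.outProb_sampleCoords]
  simp only [OracleProgram.outProb, hk _ _ _ _ _, Fin.append_left, Fin.append_right]
  rfl

end InputProgram

/-! ## Binomial expectations -/

/-- The expectation of `φ (c + X)`, for `X` binomial with `s` trials of success probability `q`. -/
def binomialExp (q : ℝ) : ℕ → ℕ → (ℕ → ℝ) → ℝ
  | 0, c, φ => φ c
  | s + 1, c, φ => q * binomialExp q s (c + 1) φ + (1 - q) * binomialExp q s c φ

section binomialExp

variable {q : ℝ}

theorem binomialExp_mono (h0 : 0 ≤ q) (h1 : q ≤ 1) {φ ψ : ℕ → ℝ} (h : ∀ c, φ c ≤ ψ c) (s c : ℕ) :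
    binomialExp q s c φ ≤ binomialExp q s c ψ := by
  induction s generalizing c with
  | zero => exact h c
  | succ s ih =>
    exact add_le_add (mul_le_mul_of_nonneg_left (ih _) h0)
      (mul_le_mul_of_nonneg_left (ih _) (by linarith))

theorem binomialExp_const (a : ℝ) (s c : ℕ) : binomialExp q s c (fun _ => a) = a := by
  induction s generalizing c with
  | zero => rfl
  | succ s ih => simp only [binomialExp, ih]; ring

theorem binomialExp_add (φ ψ : ℕ → ℝ) (s c : ℕ) :
    binomialExp q s c (fun c => φ c + ψ c) = binomialExp q s c φ + binomialExp q s c ψ := by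
  induction s generalizing c with
  | zero => rfl
  | succ s ih => simp only [binomialExp, ih]; ring

theorem binomialExp_const_mul (a : ℝ) (φ : ℕ → ℝ) (s c : ℕ) :
    binomialExp q s c (fun c => a * φ c) = a * binomialExp q s c φ := by
  induction s generalizing c with
  | zero => rfl
  | succ s ih => simp only [binomialExp, ih]; ring

theorem integrable_binomialExp {Ω : Type*} [MeasurableSpace Ω] {μ : Measure Ω} {φ : Ω → ℕ → ℝ}
    (h : ∀ c, Integrable (fun ω => φ ω c) μ) (s c : ℕ) :
    Integrable (fun ω => binomialExp q s c (φ ω)) μ := by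
  induction s generalizing c with
  | zero => exact h c
  | succ s ih => exact ((ih _).const_mul _).add ((ih _).const_mul _)

theorem integral_binomialExp {Ω : Type*} [MeasurableSpace Ω] {μ : Measure Ω} {φ : Ω → ℕ → ℝ}
    (h : ∀ c, Integrable (fun ω => φ ω c) μ) (s c : ℕ) :
    ∫ ω, binomialExp q s c (φ ω) ∂μ = binomialExp q s c fun c => ∫ ω, φ ω c ∂μ := by
  induction s generalizing c with
  | zero => rfl
  | succ s ih =>
    simp only [binomialExp]
    rw [integral_add ((integrable_binomialExp h _ _).const_mul _)
      ((integrable_binomialExp h _ _).const_mul _), integral_const_mul, integral_const_mul, ih, ih]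

theorem binomialExp_exp (l : ℝ) (s c : ℕ) :
    binomialExp q s c (fun k => Real.exp (l * k)) =
      Real.exp (l * c) * (q * Real.exp l + (1 - q)) ^ s := by
  induction s generalizing c with
  | zero => simp [binomialExp]
  | succ s ih =>
    simp only [binomialExp, ih, Nat.cast_add, Nat.cast_one, mul_add, mul_one, Real.exp_add]
    ring

/-- From `exp l - 1 - l ≤ l ^ 2` for `|l| ≤ 1`, followed by `1 + y ≤ exp y`. -/
theorem bernoulli_mgf_le (h0 : 0 ≤ q) (h1 : q ≤ 1) {l : ℝ} (hl : |l| ≤ 1) :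
    q * Real.exp l + (1 - q) ≤ Real.exp (l * q + l ^ 2) := by
  have h := (abs_le.1 (Real.abs_exp_sub_one_sub_id_le hl)).2
  have h2 : q * (Real.exp l - 1 - l) ≤ 1 * l ^ 2 := by
    refine (mul_le_mul_of_nonneg_left h h0).trans (mul_le_mul_of_nonneg_right h1 (sq_nonneg l))
  have h3 := Real.add_one_le_exp (l * q + l ^ 2)
  linarith

theorem binomialExp_exp_le (h0 : 0 ≤ q) (h1 : q ≤ 1) {l : ℝ} (hl : |l| ≤ 1) (s : ℕ) :
    binomialExp q s 0 (fun k => Real.exp (l * (k - s * q))) ≤ Real.exp (s * l ^ 2) := by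
  have e : (fun k : ℕ => Real.exp (l * (k - s * q))) =
      fun k : ℕ => Real.exp (-(l * (s * q))) * Real.exp (l * k) := by
    funext k; rw [← Real.exp_add]; ring_nf
  rw [e, binomialExp_const_mul, binomialExp_exp]
  have h2 : 0 ≤ q * Real.exp l + (1 - q) :=
    add_nonneg (mul_nonneg h0 (Real.exp_pos _).le) (by linarith)
  calc _ ≤ Real.exp (-(l * (s * q))) * (Real.exp (l * (0 : ℕ)) * Real.exp (l * q + l ^ 2) ^ s) := by
        gcongr; exact bernoulli_mgf_le h0 h1 hl
    _ = _ := by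
        rw [← Real.exp_nat_mul, ← Real.exp_add, ← Real.exp_add]; congr 1; push_cast; ring

/-- A Chernoff bound: the empirical mean of `s` trials is rarely off by more than `η`. -/
theorem le_binomialExp_of_accurate (h0 : 0 ≤ q) (h1 : q ≤ 1) {η L : ℝ} (hη : 0 ≤ η) (hη' : η ≤ 1)
    (hL : 0 ≤ L) {s : ℕ} {φ : ℕ → ℝ} (hφ : ∀ c, 0 ≤ φ c)
    (h : ∀ c : ℕ, |c - s * q| ≤ s * η → L ≤ φ c) :
    L * (1 - 2 * Real.exp (-(s * η ^ 2 / 4))) ≤ binomialExp q s 0 φ := by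
  -- This choice minimizes the Chernoff exponent `s * l ^ 2 - s * η * l`.
  set l := η / 2
  set C := Real.exp (-(s * η * l))
  have hl : |l| ≤ 1 := by rw [abs_of_nonneg (by positivity)]; simp only [l]; linarith
  -- The two exponentials dominate the indicator of an inaccurate count, for which only `0 ≤ φ c` is
  -- known.
  have key (c : ℕ) : L ≤ φ c + L * (C * Real.exp (l * (c - s * q)) +
      C * Real.exp (-l * (c - s * q))) := by
    have p1 : 0 ≤ L * (C * Real.exp (l * (c - s * q)) + C * Real.exp (-l * (c - s * q))) := by
      positivity
    by_cases hc : |(c : ℝ) - s * q| ≤ s * η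
    · linarith [h c hc]
    · have : 1 ≤ C * Real.exp (l * (c - s * q)) + C * Real.exp (-l * (c - s * q)) := by
        rcases lt_abs.1 (not_le.1 hc) with h' | h'
        · have : 1 ≤ C * Real.exp (l * (c - s * q)) := by
            rw [← Real.exp_add]; refine Real.one_le_exp ?_
            have := mul_le_mul_of_nonneg_left h'.le (show 0 ≤ l by positivity)
            linarith
          have p2 : 0 ≤ C * Real.exp (-l * (c - s * q)) := by positivity
          linarith
        · have : 1 ≤ C * Real.exp (-l * (c - s * q)) := by
            rw [← Real.exp_add]; refine Real.one_le_exp ?_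
            have := mul_le_mul_of_nonneg_left h'.le (show 0 ≤ l by positivity)
            linarith
          have p2 : 0 ≤ C * Real.exp (l * (c - s * q)) := by positivity
          linarith
      nlinarith [hφ c]
  have hmono := binomialExp_mono h0 h1 key s 0
  rw [binomialExp_const, binomialExp_add, binomialExp_const_mul, binomialExp_add,
    binomialExp_const_mul, binomialExp_const_mul] at hmono
  have b1 := mul_le_mul_of_nonneg_left (binomialExp_exp_le h0 h1 hl s) (Real.exp_pos _ : 0 < C).le
  have b2 := mul_le_mul_of_nonneg_left (binomialExp_exp_le h0 h1 (l := -l) (by rwa [abs_neg]) s)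
    (Real.exp_pos _ : 0 < C).le
  have e1 : C * Real.exp (s * l ^ 2) = Real.exp (-(s * η ^ 2 / 4)) := by
    rw [← Real.exp_add]; congr 1; simp only [l]; ring
  rw [neg_sq, e1] at b2
  rw [e1] at b1
  have := mul_le_mul_of_nonneg_left (add_le_add b1 b2) hL
  linarith

end binomialExp

/-! ## Estimation procedures -/

/-- A procedure that adaptively estimates unknown probabilities, indexed by `ι`. The answer to a
query is the number of successes in a fixed number of trials. -/
inductive EstTree (ι α : Type) : Type
  | ret (a : α) : EstTree ι α
  | est (x : ι) (k : ℕ → EstTree ι α) : EstTree ι α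

namespace EstTree

variable {ι α β : Type}

/-- Run a procedure, and then another one that depends on its result. -/
def bind : EstTree ι α → (α → EstTree ι β) → EstTree ι β
  | ret a, f => f a
  | est x k, f => est x fun c => (k c).bind f

/-- The expectation of a function of the result, for `s` trials per query. -/
def expect (q : ι → ℝ) (s : ℕ) : EstTree ι α → (α → ℝ) → ℝ
  | ret a, f => f a
  | est x k, f => binomialExp (q x) s 0 fun c => (k c).expect q s f

/-- Every result that can be reached by answers that satisfy `acc` satisfies `Q`. -/
def Ensures (acc : ι → ℕ → Prop) : EstTree ι α → (α → Prop) → Prop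
  | ret a, Q => Q a
  | est x k, Q => ∀ c, acc x c → (k c).Ensures acc Q

/-- With a budget of `N` queries the procedure never runs out of budget, and every result together
with the remaining budget satisfies `Q`. -/
def Budget : EstTree ι α → ℕ → (α → ℕ → Prop) → Prop
  | ret a, N, Q => Q a N
  | est _ _, 0, _ => False
  | est _ k, N + 1, Q => ∀ c, (k c).Budget N Q

theorem Ensures.mono {acc : ι → ℕ → Prop} {t : EstTree ι α} {P Q : α → Prop}
    (h : t.Ensures acc P) (hPQ : ∀ a, P a → Q a) : t.Ensures acc Q := by
  induction t with
  | ret a => exact hPQ a h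
  | est x k ih => exact fun c hc => ih c (h c hc)

theorem Ensures.bind {acc : ι → ℕ → Prop} {t : EstTree ι α} {f : α → EstTree ι β} {Q : β → Prop}
    (h : t.Ensures acc fun a => (f a).Ensures acc Q) : (t.bind f).Ensures acc Q := by
  induction t with
  | ret a => exact h
  | est x k ih => exact fun c hc => ih c (h c hc)

theorem Budget.mono {t : EstTree ι α} {N : ℕ} {P Q : α → ℕ → Prop} (h : t.Budget N P)
    (hPQ : ∀ a N, P a N → Q a N) : t.Budget N Q := by
  induction t generalizing N with
  | ret a => exact hPQ a N h
  | est x k ih =>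
    cases N with
    | zero => exact h
    | succ N => exact fun c => ih c (h c)

theorem Budget.bind {t : EstTree ι α} {f : α → EstTree ι β} {N : ℕ} {Q : β → ℕ → Prop}
    (h : t.Budget N fun a N => (f a).Budget N Q) : (t.bind f).Budget N Q := by
  induction t generalizing N with
  | ret a => exact h
  | est x k ih =>
    cases N with
    | zero => exact h
    | succ N => exact fun c => ih c (h c)

theorem Budget.add {t : EstTree ι α} {N M : ℕ} {P Q : α → ℕ → Prop} (h : t.Budget N P)
    (hPQ : ∀ a N, P a N → Q a (N + M)) : t.Budget (N + M) Q := by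
  induction t generalizing N with
  | ret a => exact hPQ a N h
  | est x k ih =>
    cases N with
    | zero => exact h.elim
    | succ N => rw [Nat.add_right_comm]; exact fun c => ih c (h c)

variable {q : ι → ℝ} {s : ℕ}

theorem expect_nonneg (h0 : ∀ x, 0 ≤ q x) (h1 : ∀ x, q x ≤ 1) (t : EstTree ι α) {f : α → ℝ}
    (hf : ∀ a, 0 ≤ f a) : 0 ≤ t.expect q s f := by
  induction t with
  | ret a => exact hf a
  | est x k ih =>
    have := binomialExp_mono (h0 x) (h1 x) ih s 0
    rwa [binomialExp_const] at this

theorem expect_const (t : EstTree ι α) (a : ℝ) : t.expect q s (fun _ => a) = a := by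
  induction t with
  | ret => rfl
  | est x k ih => simp only [expect, ih, binomialExp_const]

theorem expect_add (t : EstTree ι α) (f g : α → ℝ) :
    t.expect q s (fun a => f a + g a) = t.expect q s f + t.expect q s g := by
  induction t with
  | ret => rfl
  | est x k ih => simp only [expect, ih, binomialExp_add]

theorem expect_const_mul (t : EstTree ι α) (c : ℝ) (f : α → ℝ) :
    t.expect q s (fun a => c * f a) = c * t.expect q s f := by
  induction t with
  | ret => rfl
  | est x k ih => simp only [expect, ih, binomialExp_const_mul]

theorem expect_sum {κ : Type*} (u : Finset κ) (t : EstTree ι α) (f : κ → α → ℝ) :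
    t.expect q s (fun a => ∑ j ∈ u, f j a) = ∑ j ∈ u, t.expect q s (f j) := by
  classical
  induction u using Finset.induction_on with
  | empty => simp [expect_const]
  | insert j u hj ih => simp only [Finset.sum_insert hj, expect_add, ih]

theorem integrable_expect {Ω : Type*} [MeasurableSpace Ω] {μ : Measure Ω} (t : EstTree ι α)
    {f : Ω → α → ℝ} (h : ∀ a, Integrable (fun ω => f ω a) μ) :
    Integrable (fun ω => t.expect q s (f ω)) μ := by
  induction t with
  | ret a => exact h a
  | est x k ih => exact integrable_binomialExp ih _ _

theorem integral_expect {Ω : Type*} [MeasurableSpace Ω] {μ : Measure Ω} (t : EstTree ι α)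
    {f : Ω → α → ℝ} (h : ∀ a, Integrable (fun ω => f ω a) μ) :
    ∫ ω, t.expect q s (f ω) ∂μ = t.expect q s fun a => ∫ ω, f ω a ∂μ := by
  induction t with
  | ret a => rfl
  | est x k ih =>
    simp only [expect]
    rw [integral_binomialExp fun c => (k c).integrable_expect h]
    simp only [ih]

/-- Whatever the earlier answers, the next one is accurate with probability at least `1 - p`.
Branches with an inaccurate answer contribute a nonnegative amount and are dropped, so `N` adaptive
queries cost a factor `(1 - p) ^ N`, which Bernoulli's inequality bounds below by `1 - N * p`. -/
theorem le_expect_of_ensures (h0 : ∀ x, 0 ≤ q x) (h1 : ∀ x, q x ≤ 1) {η p L : ℝ} (hη : 0 ≤ η)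
    (hη' : η ≤ 1) (hp : 2 * Real.exp (-(s * η ^ 2 / 4)) ≤ p) (hp1 : p ≤ 1) (hL : 0 ≤ L)
    {t : EstTree ι α} {f : α → ℝ} (hf : ∀ a, 0 ≤ f a) {N : ℕ} (hN : t.Budget N fun _ _ => True)
    (h : t.Ensures (fun x c => |(c : ℝ) - s * q x| ≤ s * η) fun a => L ≤ f a) :
    L * (1 - N * p) ≤ t.expect q s f := by
  have hp0 : 0 ≤ p := le_trans (by positivity) hp
  suffices L * (1 - p) ^ N ≤ t.expect q s f by
    refine le_trans (mul_le_mul_of_nonneg_left ?_ hL) this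
    have := one_add_mul_le_pow (show -2 ≤ -p by linarith) N
    rw [← sub_eq_add_neg] at this
    linarith
  induction t generalizing N with
  | ret a =>
    exact (mul_le_of_le_one_right hL (pow_le_one₀ (by linarith) (by linarith))).trans h
  | est x k ih =>
    cases N with
    | zero => exact hN.elim
    | succ N =>
      have hL' : 0 ≤ L * (1 - p) ^ N := mul_nonneg hL (pow_nonneg (by linarith) _)
      refine le_trans ?_ (le_binomialExp_of_accurate (h0 x) (h1 x) hη hη' hL'
        (fun c => (k c).expect_nonneg h0 h1 hf) fun c hc => ih c (hN c) (h c hc))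
      rw [pow_succ, ← mul_assoc]
      exact mul_le_mul_of_nonneg_left (by linarith) hL'

end EstTree

/-! ## Estimation procedures as programs -/

namespace InputProgram

variable {n : ℕ}

/-- Call the algorithm oracle `s` times on profiles whose `j`-th entry is conditioned on
`[a j, b j)`, and count how often agent `i` is served. -/
def countCalls (i : Fin n) (a b : Fin n → ℝ) : ℕ → ℕ → (ℕ → InputProgram n) → InputProgram n
  | 0, c, k => k c
  | s + 1, c, k => resampleCall (fun j _ => a j) (fun j _ => b j) (fun _ => measurable_const)
      (fun _ => measurable_const) fun T => countCalls i a b s (if i ∈ T then c + 1 else c) k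

/-- Run an estimation procedure. The query `x` asks for the probability that agent `ag x` is served
if the value of each agent `j` is conditioned on `[a x j, b x j)`. -/
def ofEstTree {ι α : Type} (ag : ι → Fin n) (a b : ι → Fin n → ℝ) (s : ℕ) :
    EstTree ι α → (α → InputProgram n) → InputProgram n
  | .ret x, k => k x
  | .est x t, k => countCalls (ag x) (a x) (b x) s 0 fun c => ofEstTree ag a b s (t c) k

theorem CallsLE.countCalls {i : Fin n} {a b : Fin n → ℝ} {k : ℕ → InputProgram n} {N : ℕ}
    (hk : ∀ c, (k c).CallsLE N) (s c : ℕ) : (countCalls i a b s c k).CallsLE (N + s) := by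
  induction s generalizing c with
  | zero => exact hk c
  | succ s ih => exact CallsLE.resampleCall fun T => ih _

theorem CallsLE.ofEstTree {ι α : Type} {ag : ι → Fin n} {a b : ι → Fin n → ℝ} {s : ℕ}
    {t : EstTree ι α} {k : α → InputProgram n} {M N : ℕ} (hk : ∀ x, (k x).CallsLE M)
    (hN : t.Budget N fun _ _ => True) : (ofEstTree ag a b s t k).CallsLE (M + N * s) := by
  induction t generalizing N with
  | ret x => exact (hk x).mono (Nat.le_add_right _ _)
  | est x t ih =>
    cases N with
    | zero => exact hN.elim
    | succ N =>
      rw [Nat.succ_mul, ← Nat.add_assoc]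
      exact CallsLE.countCalls (fun c => ih c (hN c)) s 0

variable {F : Fin n → Measure ℝ} {A : Algorithm n} [∀ i, IsProbabilityMeasure (F i)]

/-- The profiles and the answers are fresh in every call, so each call is an independent trial that
succeeds with the mean of `servedProb`. -/
theorem Denotes.countCalls {i : Fin n} {a b : Fin n → ℝ} {k : ℕ → InputProgram n}
    {d : ℕ → (Fin n → ℝ) → Finset (Fin n) → ℝ} (hk : ∀ c, (k c).Denotes F A (d c)) (s c : ℕ) :
    (countCalls i a b s c k).Denotes F A fun v S => binomialExp
      (∫ w, A.servedProb i w ∂(Measure.pi fun j => sampleLaw (F j) (a j) (b j))) s c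
      fun c => d c v S := by
  induction s generalizing c with
  | zero => exact hk c
  | succ s ih =>
    intro m e r S
    rw [InputProgram.countCalls, Denotes.resampleCall (fun T => ih _) m e r S]
    have key (w : Fin n → ℝ) (y : ℕ → ℝ) :
        ∑ T, A.prob w T * y (if i ∈ T then c + 1 else c) =
          A.servedProb i w * y (c + 1) + (1 - A.servedProb i w) * y c := by
      rw [← A.sum_eq_one w, ← Finset.sum_filter_add_sum_filter_not Finset.univ (fun T => i ∈ T)
        (A.prob w), ← Finset.sum_filter_add_sum_filter_not Finset.univ (fun T => i ∈ T)]
      simp only [Algorithm.servedProb, add_sub_cancel_left, Finset.sum_mul]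
      congr 1 <;> refine Finset.sum_congr rfl fun T hT => ?_ <;> simp_all
    have hint := integrable_of_unit (μ := Measure.pi fun j => sampleLaw (F j) (a j) (b j))
      (A.measurable_servedProb i) (A.servedProb_nonneg i) (A.servedProb_le_one i)
    simp only [binomialExp]
    refine (integral_congr_ae (Filter.Eventually.of_forall fun w => key w fun c' => binomialExp
      (∫ w, A.servedProb i w ∂(Measure.pi fun j => sampleLaw (F j) (a j) (b j))) s c'
      fun c => d c (fun i => r (e i)) S)).trans ?_
    have hint' : Integrable (fun w => 1 - A.servedProb i w)
        (Measure.pi fun j => sampleLaw (F j) (a j) (b j)) := (integrable_const _).sub hint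
    rw [integral_add (hint.mul_const _) (hint'.mul_const _),
      integral_mul_const, integral_mul_const, integral_sub (integrable_const _) hint]
    simp

theorem Denotes.ofEstTree {ι α : Type} {ag : ι → Fin n} {a b : ι → Fin n → ℝ} {s : ℕ}
    (t : EstTree ι α) {k : α → InputProgram n} {d : α → (Fin n → ℝ) → Finset (Fin n) → ℝ}
    (hk : ∀ x, (k x).Denotes F A (d x)) :
    (ofEstTree ag a b s t k).Denotes F A fun v S => t.expect
      (fun x => ∫ w, A.servedProb (ag x) w ∂(Measure.pi fun j => sampleLaw (F j) (a x j) (b x j)))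
      s fun y => d y v S := by
  induction t with
  | ret x => exact hk x
  | est x t ih => exact Denotes.countCalls ih s 0

end InputProgram

/-! ## Ironing by pooling adjacent violators -/

/-- Put the block of grid cells `lo, …, hi - 1` on a stack of blocks, of which each carries its
number of successes. As long as the estimates are not increasing, the two topmost blocks are
merged. -/
def pushBlock {n : ℕ} (i : Fin n) (hi : ℕ) :
    ℕ → List (ℕ × ℕ × ℕ) → EstTree (Fin n × ℕ × ℕ) (List (ℕ × ℕ × ℕ))
  | lo, [] => .est (i, lo, hi) fun c => .ret [(lo, hi, c)]
  | lo, (lo', hi', c') :: s => .est (i, lo, hi) fun c =>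
      if c' ≤ c then .ret ((lo, hi, c) :: (lo', hi', c') :: s) else pushBlock i hi lo' s

/-- Iron the first `K` grid cells of agent `i`. -/
def ironCells {n : ℕ} (i : Fin n) : ℕ → EstTree (Fin n × ℕ × ℕ) (List (ℕ × ℕ × ℕ))
  | 0 => .ret []
  | K + 1 => (ironCells i K).bind fun s => pushBlock i (K + 1) K s

/-- Iron the first `K` grid cells of each agent of the list. -/
def ironAgents {n : ℕ} (K : ℕ) :
    List (Fin n) → EstTree (Fin n × ℕ × ℕ) (Fin n → List (ℕ × ℕ × ℕ))
  | [] => .ret fun _ => []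
  | i :: l => (ironCells i K).bind fun s => (ironAgents K l).bind fun P =>
      .ret (Function.update P i s)

/-- The block of a stack that holds the grid cell `k`. -/
def blockOf : List (ℕ × ℕ × ℕ) → ℕ → ℕ × ℕ
  -- A default value, never reached for a cell covered by an ironed stack.
  | [], k => (k, k + 1)
  | (lo, hi, _) :: s, k => if lo ≤ k then (lo, hi) else blockOf s k

/-- The blocks of the stack partition `0, …, h - 1`, their estimates are increasing, and all of them
satisfy `acc`. -/
def IsIroned (acc : ℕ → ℕ → ℕ → Prop) : ℕ → List (ℕ × ℕ × ℕ) → Prop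
  | h, [] => h = 0
  | h, (lo, hi, c) :: s => hi = h ∧ lo < h ∧ acc lo hi c ∧ (∀ y ∈ s, y.2.2 ≤ c) ∧ IsIroned acc lo s

/-- The sum of `f` over the blocks of the stack. -/
def stackSum (f : ℕ → ℕ → ℝ) (s : List (ℕ × ℕ × ℕ)) : ℝ := (s.map fun y => f y.1 y.2.1).sum

/-! ### The number of estimates -/

section Budget

variable {n : ℕ}

/-- Every estimate either ends the push, adding one block to the stack, or is followed by a merge,
removing one. Remaining budget minus stack height therefore drops by exactly two per push, however
many merges occur. -/
theorem budget_pushBlock (i : Fin n) (lo hi : ℕ) (s : List (ℕ × ℕ × ℕ)) (N : ℕ) :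
    (pushBlock i hi lo s).Budget (N + s.length + 2) fun s' N' => N' = N + s'.length := by
  induction s generalizing lo with
  | nil => exact fun c => rfl
  | cons y s ih =>
    obtain ⟨lo', hi', c'⟩ := y
    intro c
    by_cases h : c' ≤ c
    · simp only [h, if_true, EstTree.Budget]
      simp only [List.length_cons]; omega
    · simp only [h, if_false]
      exact ih lo'

theorem budget_ironCells (i : Fin n) (K N : ℕ) :
    (ironCells i K).Budget (N + 2 * K) fun s N' => N' = N + s.length := by
  induction K generalizing N with
  | zero => rfl
  | succ K ih =>
    refine EstTree.Budget.bind ?_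
    have := ih (N + 2)
    rw [show N + 2 * (K + 1) = N + 2 + 2 * K by omega]
    refine this.mono fun s N' h => ?_
    rw [h, show N + 2 + s.length = N + s.length + 2 by omega]
    exact budget_pushBlock i _ _ s N

theorem budget_ironAgents (K : ℕ) (l : List (Fin n)) :
    (ironAgents K l).Budget (l.length * (2 * K)) fun _ _ => True := by
  induction l with
  | nil => trivial
  | cons i l ih =>
    refine EstTree.Budget.bind ?_
    rw [List.length_cons, Nat.succ_mul]
    refine (budget_ironCells i K _).mono fun s N' h => ?_
    rw [h]
    refine EstTree.Budget.bind ?_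
    exact ih.add fun P N _ => trivial

end Budget

/-! ### Ironing with accurate estimates -/

section Ensures

variable {n : ℕ} {i : Fin n} {acc : Fin n × ℕ × ℕ → ℕ → Prop} {Q V : ℕ → ℕ → ℝ} {M d : ℝ}

/-- The potential `stackSum - M * length` does not decrease once the new cell has been charged `M`.
A merge happens only when the lower block has the larger count, hence by accuracy nearly the larger
probability; it then loses at most `M`, and the shorter stack refunds this amount. -/
theorem ensures_pushBlock
    (hacc : ∀ a b a' b' c c', acc (i, a, b) c → acc (i, a', b') c' → c ≤ c' → Q a b ≤ Q a' b' + d)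
    (hmerge : ∀ a b c, a < b → b < c → Q b c ≤ Q a b + d →
      V a b * Q a b + V b c * Q b c - M ≤ V a c * Q a c)
    {lo hi : ℕ} (hlt : lo < hi) {s : List (ℕ × ℕ × ℕ)}
    (hs : IsIroned (fun a b => acc (i, a, b)) lo s) :
    (pushBlock i hi lo s).Ensures acc fun s' => IsIroned (fun a b => acc (i, a, b)) hi s' ∧
      stackSum (fun a b => V a b * Q a b) s + V lo hi * Q lo hi - M * (s.length + 1) ≤
        stackSum (fun a b => V a b * Q a b) s' - M * s'.length := by
  induction s generalizing lo with
  | nil =>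
    intro c hc
    refine ⟨⟨rfl, hlt, hc, by simp, hs⟩, ?_⟩
    simp [stackSum]
  | cons y s ih =>
    obtain ⟨lo', hi', c'⟩ := y
    obtain ⟨rfl, h2, h3, h4, h5⟩ := hs
    intro c hc
    by_cases h : c' ≤ c
    · simp only [h, if_true, EstTree.Ensures]
      refine ⟨⟨rfl, hlt, hc, ?_, rfl, h2, h3, h4, h5⟩, ?_⟩
      · intro y hy
        rcases List.mem_cons.1 hy with rfl | hy
        · exact h
        · exact (h4 y hy).trans h
      · simp only [stackSum, List.map_cons, List.sum_cons, List.length_cons, Nat.cast_add,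
          Nat.cast_one]
        linarith
    · simp only [h, if_false]
      refine (ih (h2.trans hlt) h5).mono fun s' hs' => ⟨hs'.1, ?_⟩
      have := hmerge _ _ _ h2 hlt (hacc _ _ _ _ _ _ hc h3 (le_of_not_ge h))
      refine le_trans ?_ hs'.2
      simp only [stackSum, List.map_cons, List.sum_cons, List.length_cons, Nat.cast_add,
          Nat.cast_one]
      linarith

theorem ensures_ironCells
    (hacc : ∀ a b a' b' c c', acc (i, a, b) c → acc (i, a', b') c' → c ≤ c' → Q a b ≤ Q a' b' + d)
    (hmerge : ∀ a b c, a < b → b < c → Q b c ≤ Q a b + d →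
      V a b * Q a b + V b c * Q b c - M ≤ V a c * Q a c) (K : ℕ) :
    (ironCells i K).Ensures acc fun s => IsIroned (fun a b => acc (i, a, b)) K s ∧
      ∑ k ∈ Finset.range K, V k (k + 1) * Q k (k + 1) - M * K ≤
        stackSum (fun a b => V a b * Q a b) s - M * s.length := by
  induction K with
  | zero => simp [ironCells, EstTree.Ensures, IsIroned, stackSum]
  | succ K ih =>
    refine EstTree.Ensures.bind (ih.mono fun s hs => ?_)
    refine (ensures_pushBlock hacc hmerge (Nat.lt_succ_self K) hs.1).mono fun s' hs' => ⟨hs'.1, ?_⟩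
    refine le_trans ?_ hs'.2
    rw [Finset.sum_range_succ]
    push_cast
    linarith [hs.2]

theorem ensures_ironAgents {K : ℕ} {I : Fin n → List (ℕ × ℕ × ℕ) → Prop}
    (h : ∀ i, (ironCells i K).Ensures acc (I i)) (l : List (Fin n)) :
    (ironAgents K l).Ensures acc fun P => ∀ i ∈ l, I i (P i) := by
  induction l with
  | nil => simp [ironAgents, EstTree.Ensures]
  | cons i l ih =>
    refine EstTree.Ensures.bind ((h i).mono fun s hs => ?_)
    refine EstTree.Ensures.bind (ih.mono fun P hP => ?_)
    intro j hj
    by_cases hji : j = i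
    · subst hji; simpa
    · rw [Function.update_of_ne hji]
      exact hP j ((List.mem_cons.1 hj).resolve_left hji)

end Ensures

/-! ### Monotonicity across blocks -/

section blockOf

variable {acc : ℕ → ℕ → ℕ → Prop}

theorem exists_mem_of_isIroned {h : ℕ} {s : List (ℕ × ℕ × ℕ)} (hs : IsIroned acc h s) {k : ℕ}
    (hk : k < h) :
    ∃ c, ((blockOf s k).1, (blockOf s k).2, c) ∈ s ∧ acc (blockOf s k).1 (blockOf s k).2 c := by
  induction s generalizing h with
  | nil => simp only [IsIroned] at hs; omega
  | cons y s ih =>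
    obtain ⟨lo, hi, c⟩ := y
    obtain ⟨rfl, h2, h3, h4, h5⟩ := hs
    by_cases hlo : lo ≤ k
    · simp only [blockOf, hlo, if_true]
      exact ⟨c, by simp, h3⟩
    · simp only [blockOf, hlo, if_false]
      obtain ⟨c', hc'⟩ := ih h5 (not_le.1 hlo)
      exact ⟨c', List.mem_cons_of_mem _ hc'.1, hc'.2⟩

/-- The counts are sorted along the stack, and accuracy transfers their order to the true
probabilities up to `d`. Two cells of the same block need only `0 ≤ d`. -/
theorem blockOf_mono {Q : ℕ → ℕ → ℝ} {d : ℝ} (hd : 0 ≤ d)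
    (hacc : ∀ a b a' b' c c', acc a b c → acc a' b' c' → c ≤ c' → Q a b ≤ Q a' b' + d)
    {h : ℕ} {s : List (ℕ × ℕ × ℕ)} (hs : IsIroned acc h s) {k k' : ℕ} (hkk : k ≤ k')
    (hk : k' < h) :
    Q (blockOf s k).1 (blockOf s k).2 ≤ Q (blockOf s k').1 (blockOf s k').2 + d := by
  induction s generalizing h with
  | nil => simp only [IsIroned] at hs; omega
  | cons y s ih =>
    obtain ⟨lo, hi, c⟩ := y
    obtain ⟨rfl, h2, h3, h4, h5⟩ := hs
    by_cases hlo : lo ≤ k'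
    · by_cases hlo' : lo ≤ k
      · simp only [blockOf, hlo, hlo', if_true]
        linarith
      · simp only [blockOf, hlo, hlo', if_true, if_false]
        obtain ⟨c', hc', hc2⟩ := exists_mem_of_isIroned h5 (not_le.1 hlo')
        exact hacc _ _ _ _ _ _ hc2 h3 (h4 _ hc')
    · have hlo' : ¬ lo ≤ k := fun h => hlo (h.trans hkk)
      simp only [blockOf, hlo, hlo', if_false]
      exact ih h5 (not_le.1 hlo)

end blockOf

/-! ## Conditioning on the cells of a grid -/

theorem sampleLaw_mul_measure (μ : Measure ℝ) [IsProbabilityMeasure μ] (a b : ℝ) (E : Set ℝ) :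
    sampleLaw μ a b E * μ (Set.Ico a b) = μ (Set.Ico a b ∩ E) := by
  unfold sampleLaw
  split_ifs with h
  · rw [h, mul_zero, measure_mono_null Set.inter_subset_left h]
  · rw [mul_comm, mul_comm, cond_mul_eq_inter measurableSet_Ico]

/-- On a null interval both sides vanish, so the arbitrary answer of the oracle there never affects
the analysis. -/
theorem integral_sampleLaw_mul (μ : Measure ℝ) [IsProbabilityMeasure μ] (a b : ℝ) (f : ℝ → ℝ) :
    μ.real (Set.Ico a b) * ∫ x, f x ∂(sampleLaw μ a b) = ∫ x in Set.Ico a b, f x ∂μ := by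
  unfold sampleLaw
  split_ifs with h
  · rw [measureReal_def, h, Measure.restrict_eq_zero.2 h]; simp
  · rw [ProbabilityTheory.cond, integral_smul_measure, smul_eq_mul, ← mul_assoc, measureReal_def,
      ENNReal.toReal_inv, mul_inv_cancel₀, one_mul]
    exact ENNReal.toReal_ne_zero.2 ⟨h, measure_ne_top _ _⟩

/-- Unconditional draws are obtained from the conditional oracle by querying an interval of full
measure. -/
theorem sampleLaw_of_ae (μ : Measure ℝ) [IsProbabilityMeasure μ] {a b : ℝ}
    (h : ∀ᵐ x ∂μ, x ∈ Set.Ico a b) : sampleLaw μ a b = μ := by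
  have h1 : μ (Set.Ico a b) = 1 := (mem_ae_iff_prob_eq_one measurableSet_Ico).1 h
  have h2 : μ.restrict (Set.Ico a b) = μ := Measure.restrict_eq_self_of_ae_mem h
  unfold sampleLaw
  rw [if_neg (by rw [h1]; exact one_ne_zero), ProbabilityTheory.cond, h1, h2]
  simp

/-- The cell of the grid `t` that holds `x`, among the first `K + 1` cells. -/
noncomputable def level (t : ℕ → ℝ) (K : ℕ) (x : ℝ) : ℕ :=
  open Classical in ((Finset.range K).filter fun k => t (k + 1) ≤ x).card

/-! ### Locating a value in the grid -/

section level

variable {t : ℕ → ℝ} {K : ℕ}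

theorem level_mono {x y : ℝ} (h : x ≤ y) : level t K x ≤ level t K y := by
  classical
  refine Finset.card_le_card fun k hk => ?_
  simp only [Finset.mem_filter] at hk ⊢
  exact ⟨hk.1, hk.2.trans h⟩

theorem level_le (x : ℝ) : level t K x ≤ K := by
  classical
  exact (Finset.card_filter_le _ _).trans (Finset.card_range K).le

theorem measurable_level : Measurable (level t K) :=
  (Monotone.measurable fun _ _ h => level_mono h)

theorem level_eq (ht : StrictMono t) {k : ℕ} (hk : k ≤ K) {x : ℝ}
    (hx : x ∈ Set.Ico (t k) (t (k + 1))) : level t K x = k := by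
  classical
  have : ((Finset.range K).filter fun j => t (j + 1) ≤ x) = Finset.range k := by
    ext j
    simp only [Finset.mem_filter, Finset.mem_range]
    constructor
    · rintro ⟨-, h⟩
      have := ht.lt_iff_lt.1 (h.trans_lt hx.2)
      omega
    · intro h
      exact ⟨h.trans_le hk, (ht.monotone (Nat.succ_le_of_lt h)).trans hx.1⟩
  simp only [level]
  convert Finset.card_range k

theorem exists_cell {x : ℝ} {h : ℕ} (hx : x ∈ Set.Ico (t 0) (t h)) :
    ∃ k < h, x ∈ Set.Ico (t k) (t (k + 1)) := by
  induction h with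
  | zero => exact absurd hx (by simp)
  | succ h ih =>
    by_cases hh : x < t h
    · obtain ⟨k, hk, hk'⟩ := ih ⟨hx.1, hh⟩
      exact ⟨k, hk.trans (Nat.lt_succ_self h), hk'⟩
    · exact ⟨h, Nat.lt_succ_self h, not_lt.1 hh, hx.2⟩

theorem level_lt (ht : StrictMono t) {x : ℝ} {h : ℕ} (hh : h ≤ K) (hx : x ∈ Set.Ico (t 0) (t h)) :
    level t K x < h := by
  obtain ⟨k, hk, hk'⟩ := exists_cell hx
  rwa [level_eq ht (hk.le.trans hh) hk']

theorem le_level (ht : StrictMono t) {x : ℝ} {a b : ℕ} (hb : b ≤ K)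
    (hx : x ∈ Set.Ico (t a) (t b)) : a ≤ level t K x := by
  obtain ⟨k, hk, hk'⟩ := exists_cell ⟨(ht.monotone (Nat.zero_le a)).trans hx.1, hx.2⟩
  rw [level_eq ht (hk.le.trans hb) hk']
  have := ht.lt_iff_lt.1 (hx.1.trans_lt hk'.2)
  omega

end level

theorem Ico_union_grid {t : ℕ → ℝ} (ht : StrictMono t) {a b c : ℕ} (hab : a ≤ b) (hbc : b ≤ c) :
    Set.Ico (t a) (t b) ∪ Set.Ico (t b) (t c) = Set.Ico (t a) (t c) :=
  Set.Ico_union_Ico_eq_Ico (ht.monotone hab) (ht.monotone hbc)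

/-- Draw again from the conditional distribution of the block that holds `x`. -/
noncomputable def blockLaw (μ : Measure ℝ) (t : ℕ → ℝ) (K : ℕ) (s : List (ℕ × ℕ × ℕ)) (x : ℝ) :
    Measure ℝ :=
  sampleLaw μ (t (blockOf s (level t K x)).1) (t (blockOf s (level t K x)).2)

theorem measurable_blockLaw {μ : Measure ℝ} {t : ℕ → ℝ} {K : ℕ} {s : List (ℕ × ℕ × ℕ)} :
    Measurable (blockLaw μ t K s) :=
  (Measurable.of_discrete (f := fun k : ℕ => sampleLaw μ (t (blockOf s k).1) (t (blockOf s k).2))).comp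
    measurable_level

section blockLaw

variable {μ : Measure ℝ} [IsProbabilityMeasure μ] {t : ℕ → ℝ} {K : ℕ} {s : List (ℕ × ℕ × ℕ)}

instance (x : ℝ) : IsProbabilityMeasure (blockLaw μ t K s x) :=
  isProbabilityMeasure_sampleLaw _ _ _

/-- Values in the top block are redrawn from its own conditional law, which restores the mass of `E`
there. Values below see only the rest of the stack, hence the induction over partial heights `h ≤
K`. -/
theorem setLIntegral_blockLaw (ht : StrictMono t) {acc : ℕ → ℕ → ℕ → Prop} {E : Set ℝ}
    (hE : MeasurableSet E) {h : ℕ} (hh : h ≤ K) (hs : IsIroned acc h s) :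
    ∫⁻ x in Set.Ico (t 0) (t h), blockLaw μ t K s x E ∂μ = μ (Set.Ico (t 0) (t h) ∩ E) := by
  induction s generalizing h with
  | nil => simp only [IsIroned] at hs; subst hs; simp
  | cons y s ih =>
    obtain ⟨lo, hi, c⟩ := y
    obtain ⟨rfl, h2, h3, h4, h5⟩ := hs
    rw [← Ico_union_grid ht (Nat.zero_le lo) h2.le, Set.union_inter_distrib_right,
      lintegral_union measurableSet_Ico (Set.Ico_disjoint_Ico_same),
      measure_union (Set.Ico_disjoint_Ico_same.mono Set.inter_subset_left Set.inter_subset_left)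
      (measurableSet_Ico.inter hE), ← ih (h2.le.trans hh) h5]
    congr 1
    · refine setLIntegral_congr_fun measurableSet_Ico fun x hx => ?_
      have := level_lt ht (h2.le.trans hh) hx
      simp only [blockLaw, blockOf, not_le.2 this, if_false]
    · rw [setLIntegral_congr_fun (g := fun _ => sampleLaw μ (t lo) (t hi) E) measurableSet_Ico
        fun x hx => by
          simp only [blockLaw, blockOf, le_level ht hh hx, if_true]]
      rw [setLIntegral_const, sampleLaw_mul_measure]

/-- Choosing a block with its own probability and then a value from its conditional law is a
two-stage draw from `μ`. -/
theorem bind_blockLaw (ht : StrictMono t) {acc : ℕ → ℕ → ℕ → Prop} (hs : IsIroned acc K s)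
    (hμ : ∀ᵐ x ∂μ, x ∈ Set.Ico (t 0) (t K)) : μ.bind (blockLaw μ t K s) = μ := by
  ext E hE
  have := setLIntegral_blockLaw (μ := μ) ht hE le_rfl hs
  rw [Measure.restrict_eq_self_of_ae_mem hμ] at this
  rw [Measure.bind_apply hE measurable_blockLaw.aemeasurable, this]
  refine measure_congr ?_
  filter_upwards [hμ] with x hx
  exact propext ⟨fun h => h.2, fun h => ⟨hx, h⟩⟩

variable {f : ℝ → ℝ}

/-- The redrawing law is constant on each block, so its mean factors out of the integral over that
block. -/
theorem setIntegral_mul_blockLaw (ht : StrictMono t) {acc : ℕ → ℕ → ℕ → Prop} {h : ℕ} (hh : h ≤ K)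
    (hs : IsIroned acc h s) (hf : Measurable f) (h0 : ∀ x, 0 ≤ f x) (h1 : ∀ x, f x ≤ 1)
    (hμ : Integrable (fun x => x) μ) :
    ∫ x in Set.Ico (t 0) (t h), x * ∫ y, f y ∂(blockLaw μ t K s x) ∂μ =
      stackSum (fun a b => (∫ x in Set.Ico (t a) (t b), x ∂μ) *
        ∫ y, f y ∂(sampleLaw μ (t a) (t b))) s := by
  induction s generalizing h with
  | nil => simp only [IsIroned] at hs; subst hs; simp [stackSum]
  | cons y s ih =>
    have hm : Measurable fun x => ∫ y, f y ∂(blockLaw μ t K (y :: s) x) :=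
      (Measurable.of_discrete (f := fun k : ℕ => ∫ z, f z ∂(sampleLaw μ (t (blockOf (y :: s) k).1)
        (t (blockOf (y :: s) k).2)))).comp measurable_level
    have hint : Integrable (fun x => x * ∫ y, f y ∂(blockLaw μ t K (y :: s) x)) μ :=
      hμ.mul_bdd (c := 1) hm.aestronglyMeasurable (Filter.Eventually.of_forall fun x => by
        rw [Real.norm_eq_abs, abs_of_nonneg (integral_nonneg h0)]
        calc _ ≤ ∫ _, (1 : ℝ) ∂(blockLaw μ t K (y :: s) x) :=
              integral_mono (integrable_of_unit hf h0 h1) (integrable_const _) h1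
          _ = 1 := by simp)
    obtain ⟨lo, hi, c⟩ := y
    obtain ⟨rfl, h2, h3, h4, h5⟩ := hs
    rw [← Ico_union_grid ht (Nat.zero_le lo) h2.le,
      setIntegral_union Set.Ico_disjoint_Ico_same measurableSet_Ico hint.integrableOn
      hint.integrableOn, stackSum, List.map_cons, List.sum_cons, add_comm]
    congr 1
    · rw [← integral_mul_const]
      refine setIntegral_congr_fun measurableSet_Ico fun x hx => ?_
      simp only [blockLaw, blockOf, le_level ht hh hx, if_true]
    · refine Eq.trans ?_ (ih (h2.le.trans hh) h5)
      refine setIntegral_congr_fun measurableSet_Ico fun x hx => ?_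
      have := level_lt ht (h2.le.trans hh) hx
      simp only [blockLaw, blockOf, not_le.2 this, if_false]

theorem integral_mul_blockLaw (ht : StrictMono t) {acc : ℕ → ℕ → ℕ → Prop}
    (hs : IsIroned acc K s) (hf : Measurable f) (h0 : ∀ x, 0 ≤ f x) (h1 : ∀ x, f x ≤ 1)
    (hμ : ∀ᵐ x ∂μ, x ∈ Set.Ico (t 0) (t K)) (hμ' : Integrable (fun x => x) μ) :
    ∫ x, x * ∫ y, f y ∂(blockLaw μ t K s x) ∂μ =
      stackSum (fun a b => (∫ x in Set.Ico (t a) (t b), x ∂μ) *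
        ∫ y, f y ∂(sampleLaw μ (t a) (t b))) s := by
  rw [← setIntegral_mul_blockLaw ht le_rfl hs hf h0 h1 hμ',
    Measure.restrict_eq_self_of_ae_mem hμ]

end blockLaw

/-! ## Welfare of ironing -/

/-- Multiplied by `p₁ + p₂`, merging changes the value by exactly `(v₂ * p₁ - v₁ * p₂) * (q₁ - q₂)`.
The first factor is nonnegative since `c` separates the mean values of the two blocks, and it is at
most `v₂ * (p₁ + p₂)`; the second is at least `-d`. -/
theorem merge_le_aux {p₁ p₂ v₁ v₂ q₁ q₂ q c d : ℝ} (hp₁ : 0 ≤ p₁) (hp₂ : 0 ≤ p₂) (hv₁ : 0 ≤ v₁)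
    (hv₂ : 0 ≤ v₂) (h₁ : v₁ ≤ c * p₁) (h₂ : c * p₂ ≤ v₂) (h₁' : p₁ = 0 → v₁ = 0)
    (h₂' : p₂ = 0 → v₂ = 0) (hq : (p₁ + p₂) * q = p₁ * q₁ + p₂ * q₂) (hd : 0 ≤ d)
    (hle : q₂ ≤ q₁ + d) : v₁ * q₁ + v₂ * q₂ - d * v₂ ≤ (v₁ + v₂) * q := by
  rcases (add_nonneg hp₁ hp₂).eq_or_lt with h | h
  · have e1 : p₁ = 0 := by linarith
    have e2 : p₂ = 0 := by linarith
    rw [h₁' e1, h₂' e2]; simp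
  · refine le_of_mul_le_mul_left ?_ h
    have e : (p₁ + p₂) * ((v₁ + v₂) * q) = (v₁ + v₂) * (p₁ * q₁ + p₂ * q₂) := by
      rw [← hq]; ring
    rw [e]
    have k1 : 0 ≤ v₂ * p₁ - v₁ * p₂ := by
      nlinarith [mul_le_mul_of_nonneg_right h₁ hp₂, mul_le_mul_of_nonneg_right h₂ hp₁]
    nlinarith [mul_nonneg k1 (show 0 ≤ q₁ + d - q₂ by linarith), mul_nonneg hd (mul_nonneg hv₁ hp₂),
      mul_nonneg hd (mul_nonneg hv₂ hp₂)]

theorem setIntegral_Ico_nonneg {μ : Measure ℝ} {t : ℕ → ℝ} (ht : StrictMono t) (h0 : t 0 = 0)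
    (a b : ℕ) :
    0 ≤ ∫ x in Set.Ico (t a) (t b), x ∂μ :=
  setIntegral_nonneg measurableSet_Ico fun x hx => by
    have := ht.monotone (Nat.zero_le a)
    linarith [hx.1]

section

variable {μ : Measure ℝ} [IsProbabilityMeasure μ] {t : ℕ → ℝ} {f : ℝ → ℝ}

/-- The grid point `t b` plays the role of the separating value `c` in `merge_le_aux`. The value of
the upper block is at most the whole mean, which makes the loss independent of the blocks. -/
theorem merge_le (ht : StrictMono t) (ht0 : t 0 = 0) (hf : Measurable f) (h0 : ∀ x, 0 ≤ f x)
    (h1 : ∀ x, f x ≤ 1) (hμ : Integrable (fun x => x) μ) (hpos : ∀ᵐ x ∂μ, 0 ≤ x) {d : ℝ}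
    (hd : 0 ≤ d) {a b c : ℕ} (hab : a < b) (hbc : b < c)
    (hle : ∫ y, f y ∂(sampleLaw μ (t b) (t c)) ≤ ∫ y, f y ∂(sampleLaw μ (t a) (t b)) + d) :
    (∫ x in Set.Ico (t a) (t b), x ∂μ) * ∫ y, f y ∂(sampleLaw μ (t a) (t b)) +
      (∫ x in Set.Ico (t b) (t c), x ∂μ) * ∫ y, f y ∂(sampleLaw μ (t b) (t c)) -
        d * ∫ x, x ∂μ ≤
      (∫ x in Set.Ico (t a) (t c), x ∂μ) * ∫ y, f y ∂(sampleLaw μ (t a) (t c)) := by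
  have hfi : Integrable f μ := integrable_of_unit hf h0 h1
  have hzero (a b : ℕ) (h : μ.real (Set.Ico (t a) (t b)) = 0) :
      ∫ x in Set.Ico (t a) (t b), x ∂μ = 0 := by
    rw [measureReal_def, ENNReal.toReal_eq_zero_iff] at h
    rw [Measure.restrict_eq_zero.2 (h.resolve_right (measure_ne_top _ _)), integral_zero_measure]
  have hunion := Ico_union_grid ht hab.le hbc.le
  have hV : ∫ x in Set.Ico (t a) (t c), x ∂μ =
      (∫ x in Set.Ico (t a) (t b), x ∂μ) + ∫ x in Set.Ico (t b) (t c), x ∂μ := by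
    rw [← hunion, setIntegral_union Set.Ico_disjoint_Ico_same measurableSet_Ico hμ.integrableOn
      hμ.integrableOn]
  have hQ : ∫ x in Set.Ico (t a) (t c), f x ∂μ =
      (∫ x in Set.Ico (t a) (t b), f x ∂μ) + ∫ x in Set.Ico (t b) (t c), f x ∂μ := by
    rw [← hunion, setIntegral_union Set.Ico_disjoint_Ico_same measurableSet_Ico hfi.integrableOn
      hfi.integrableOn]
  have hP : μ.real (Set.Ico (t a) (t c)) =
      μ.real (Set.Ico (t a) (t b)) + μ.real (Set.Ico (t b) (t c)) := by
    rw [← hunion, measureReal_union Set.Ico_disjoint_Ico_same measurableSet_Ico]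
  have hle2 : ∫ x in Set.Ico (t b) (t c), x ∂μ ≤ ∫ x, x ∂μ :=
    setIntegral_le_integral hμ hpos
  have b1 : ∫ x in Set.Ico (t a) (t b), x ∂μ ≤ t b * μ.real (Set.Ico (t a) (t b)) := by
    have := setIntegral_mono_on (μ := μ) (s := Set.Ico (t a) (t b)) hμ.integrableOn
      (integrable_const (t b)).integrableOn measurableSet_Ico fun x hx => hx.2.le
    rwa [setIntegral_const, smul_eq_mul, mul_comm] at this
  have b2 : t b * μ.real (Set.Ico (t b) (t c)) ≤ ∫ x in Set.Ico (t b) (t c), x ∂μ := by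
    have := setIntegral_mono_on (μ := μ) (s := Set.Ico (t b) (t c))
      (integrable_const (t b)).integrableOn hμ.integrableOn measurableSet_Ico fun x hx => hx.1
    rwa [setIntegral_const, smul_eq_mul, mul_comm] at this
  have key := merge_le_aux (q := ∫ y, f y ∂(sampleLaw μ (t a) (t c))) measureReal_nonneg
    measureReal_nonneg (setIntegral_Ico_nonneg (μ := μ) ht ht0 a b)
    (setIntegral_Ico_nonneg (μ := μ) ht ht0 b c) b1 b2 (hzero a b) (hzero b c)
    (by rw [← hP, integral_sampleLaw_mul, hQ, integral_sampleLaw_mul, integral_sampleLaw_mul])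
    hd hle
  rw [hV]
  refine le_trans ?_ key
  linarith [mul_le_mul_of_nonneg_left hle2 hd]

/-- In every cell but the first, values differ by a factor of at most `r`, so replacing `f` by its
conditional mean costs at most that factor. The first cell starts at `0` and has no such ratio, but
contributes at most `t 1`. -/
theorem le_sum_cells (ht : StrictMono t) (ht0 : t 0 = 0) {r : ℝ} (hr : 1 ≤ r)
    (htr : ∀ k, t (k + 2) ≤ r * t (k + 1)) (hf : Measurable f) (h0 : ∀ x, 0 ≤ f x)
    (h1 : ∀ x, f x ≤ 1) (hμ : Integrable (fun x => x) μ) (K : ℕ) :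
    (∫ x in Set.Ico (t 0) (t K), x * f x ∂μ) - t 1 ≤
      r * ∑ k ∈ Finset.range K, (∫ x in Set.Ico (t k) (t (k + 1)), x ∂μ) *
        ∫ y, f y ∂(sampleLaw μ (t k) (t (k + 1))) := by
  have ht1 : 0 < t 1 := by rw [← ht0]; exact ht Nat.zero_lt_one
  have hfi : Integrable f μ := integrable_of_unit hf h0 h1
  have hxf : Integrable (fun x => x * f x) μ :=
    hμ.mul_bdd (c := 1) hf.aestronglyMeasurable (Filter.Eventually.of_forall fun x => by
      rw [Real.norm_eq_abs, abs_of_nonneg (h0 x)]; exact h1 x)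
  have hnn (k : ℕ) : 0 ≤ (∫ x in Set.Ico (t k) (t (k + 1)), x ∂μ) *
      ∫ y, f y ∂(sampleLaw μ (t k) (t (k + 1))) :=
    mul_nonneg (setIntegral_Ico_nonneg ht ht0 _ _) (integral_nonneg h0)
  have hcell (k : ℕ) : ∫ x in Set.Ico (t (k + 1)) (t (k + 2)), x * f x ∂μ ≤
      r * ((∫ x in Set.Ico (t (k + 1)) (t (k + 2)), x ∂μ) *
        ∫ y, f y ∂(sampleLaw μ (t (k + 1)) (t (k + 2)))) := by
    have hq : 0 ≤ ∫ y, f y ∂(sampleLaw μ (t (k + 1)) (t (k + 2))) := integral_nonneg h0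
    have hlow : t (k + 1) * μ.real (Set.Ico (t (k + 1)) (t (k + 2))) ≤
        ∫ x in Set.Ico (t (k + 1)) (t (k + 2)), x ∂μ := by
      have := setIntegral_mono_on (μ := μ) (s := Set.Ico (t (k + 1)) (t (k + 2)))
        (integrable_const (t (k + 1))).integrableOn hμ.integrableOn measurableSet_Ico
        fun x hx => hx.1
      rwa [setIntegral_const, smul_eq_mul, mul_comm] at this
    calc _ ≤ ∫ x in Set.Ico (t (k + 1)) (t (k + 2)), t (k + 2) * f x ∂μ :=
          setIntegral_mono_on hxf.integrableOn (hfi.const_mul _).integrableOn measurableSet_Ico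
            fun x hx => mul_le_mul_of_nonneg_right hx.2.le (h0 x)
      _ = t (k + 2) * (μ.real (Set.Ico (t (k + 1)) (t (k + 2))) *
            ∫ y, f y ∂(sampleLaw μ (t (k + 1)) (t (k + 2)))) := by
          rw [integral_const_mul, integral_sampleLaw_mul]
      _ ≤ r * t (k + 1) * (μ.real (Set.Ico (t (k + 1)) (t (k + 2))) *
            ∫ y, f y ∂(sampleLaw μ (t (k + 1)) (t (k + 2)))) :=
          mul_le_mul_of_nonneg_right (htr k) (mul_nonneg measureReal_nonneg hq)
      _ ≤ _ := by
          rw [mul_assoc, ← mul_assoc (t (k + 1))]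
          exact mul_le_mul_of_nonneg_left (mul_le_mul_of_nonneg_right hlow hq) (by linarith)
  cases K with
  | zero => simp; linarith
  | succ K =>
    induction K with
    | zero =>
      have : ∫ x in Set.Ico (t 0) (t 1), x * f x ∂μ ≤ t 1 := by
        calc _ ≤ ∫ x in Set.Ico (t 0) (t 1), t 1 ∂μ :=
              setIntegral_mono_on hxf.integrableOn (integrable_const _).integrableOn
                measurableSet_Ico fun x hx => by
                  have hx0 : 0 ≤ x := by rw [← ht0]; exact hx.1
                  exact (mul_le_of_le_one_right hx0 (h1 x)).trans hx.2.le
          _ ≤ 1 * t 1 := by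
              rw [setIntegral_const, smul_eq_mul]
              exact mul_le_mul_of_nonneg_right measureReal_le_one ht1.le
          _ = t 1 := one_mul _
      have h2 := mul_nonneg (show 0 ≤ r by linarith) (hnn 0)
      simp only [zero_add, Finset.range_one, Finset.sum_singleton] at h2 ⊢
      linarith
    | succ K ih =>
      rw [← Ico_union_grid ht (Nat.zero_le (K + 1)) (Nat.le_succ (K + 1)),
        setIntegral_union Set.Ico_disjoint_Ico_same measurableSet_Ico hxf.integrableOn
        hxf.integrableOn, Finset.sum_range_succ, mul_add]
      have := hcell K
      linarith

end

/-! ## The reduction, for an arbitrary grid -/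

namespace InputProgram

variable {n : ℕ}

/-- Draw the value of each agent again from its block, and run the given algorithm. -/
noncomputable def ironed (t : ℕ → ℝ) (K : ℕ) (P : Fin n → List (ℕ × ℕ × ℕ)) : InputProgram n :=
  resampleCall (fun j x => t (blockOf (P j) (level t K x)).1)
    (fun j x => t (blockOf (P j) (level t K x)).2)
    (fun j => (Measurable.of_discrete (f := fun k => t (blockOf (P j) k).1)).comp measurable_level)
    (fun j => (Measurable.of_discrete (f := fun k => t (blockOf (P j) k).2)).comp measurable_level)
    serve

/-- Estimate where the allocation is not monotone, with `s` calls per estimate, and run the given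
algorithm ironed accordingly. -/
noncomputable def estimateAndIron (n : ℕ) (t : ℕ → ℝ) (K s : ℕ) : InputProgram n :=
  ofEstTree (fun x : Fin n × ℕ × ℕ => x.1) (fun x => Function.update (fun _ => t 0) x.1 (t x.2.1))
    (fun x => Function.update (fun _ => t K) x.1 (t x.2.2)) s (ironAgents K (List.finRange n))
    (ironed t K)

/-- For each agent `i` of the list in turn, stop with probability `w` and serve `i` alone with
probability `g (v i)`. -/
def lottery (w : ℝ) (g : ℝ → ℝ) (hg : Measurable g) (P : InputProgram n) :
    List (Fin n) → InputProgram n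
  | [] => P
  | i :: l => coin (fun _ => w) measurable_const
      (coin (fun v => g (v i)) (hg.comp (measurable_pi_apply i)) (serve {i}) (serve ∅))
      (lottery w g hg P l)

theorem CallsLE.lottery {w : ℝ} {g : ℝ → ℝ} {hg : Measurable g} {P : InputProgram n} {N : ℕ}
    (h : P.CallsLE N) (l : List (Fin n)) : (lottery w g hg P l).CallsLE N := by
  induction l with
  | nil => exact h
  | cons i l ih => exact CallsLE.coin (CallsLE.coin (callsLE_serve _ _) (callsLE_serve _ _)) ih

/-- The chance of agent `i` in the lottery grows with the cell of its value. -/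
noncomputable def cellWeight (t : ℕ → ℝ) (K : ℕ) (x : ℝ) : ℝ := 1 / 2 + level t K x / (2 * K)

theorem measurable_cellWeight (t : ℕ → ℝ) (K : ℕ) : Measurable (cellWeight t K) :=
  (Measurable.of_discrete (f := fun k : ℕ => (1 / 2 + k / (2 * K) : ℝ))).comp measurable_level

/-- The complete reduction. -/
noncomputable def reduction (n : ℕ) (t : ℕ → ℝ) (K s : ℕ) (w : ℝ) : InputProgram n :=
  lottery w (cellWeight t K) (measurable_cellWeight t K) (estimateAndIron n t K s)
    (List.finRange n)

theorem callsLE_reduction (t : ℕ → ℝ) (K s : ℕ) (w : ℝ) :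
    (reduction n t K s w).CallsLE (1 + n * (2 * K) * s) := by
  refine CallsLE.lottery (CallsLE.ofEstTree (fun P => ?_) ?_) _
  · exact CallsLE.resampleCall (N := 0) fun T => callsLE_serve _ _
  · simpa using budget_ironAgents K (List.finRange n)

end InputProgram

open InputProgram

/-- The probability that agent `x.1` is served if its value is conditioned on `[t x.2.1, t x.2.2)`
and the other values are drawn from their distributions. -/
noncomputable def cellProb {n : ℕ} (F : Fin n → Measure ℝ) (A : Algorithm n) (t : ℕ → ℝ)
    (x : Fin n × ℕ × ℕ) : ℝ :=
  ∫ y, A.interim F x.1 y ∂(sampleLaw (F x.1) (t x.2.1) (t x.2.2))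

theorem cellProb_nonneg {n : ℕ} (F : Fin n → Measure ℝ) (A : Algorithm n) (t : ℕ → ℝ)
    (x : Fin n × ℕ × ℕ) : 0 ≤ cellProb F A t x :=
  integral_nonneg fun _ => A.interim_nonneg F _ _

section

variable {n : ℕ} (F : Fin n → Measure ℝ) [∀ i, IsProbabilityMeasure (F i)] (A : Algorithm n)

/-- The algorithm computed by a program that reads the reported profile only. -/
noncomputable def InputProgram.algorithm (P : InputProgram n) : Algorithm n :=
  (P n id).toAlgorithm F A

theorem InputProgram.Denotes.algorithm_prob {F : Fin n → Measure ℝ}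
    [∀ i, IsProbabilityMeasure (F i)] {A : Algorithm n} {P : InputProgram n}
    {d : (Fin n → ℝ) → Finset (Fin n) → ℝ} (h : P.Denotes F A d) (v : Fin n → ℝ)
    (S : Finset (Fin n)) : (P.algorithm F A).prob v S = d v S := h n id v S

theorem denotes_self_of_denotes {F : Fin n → Measure ℝ}
    [∀ i, IsProbabilityMeasure (F i)] {A : Algorithm n} {P : InputProgram n}
    {d : (Fin n → ℝ) → Finset (Fin n) → ℝ} (h : P.Denotes F A d) :
    P.Denotes F A (P.algorithm F A).prob := fun m e r S => by
  rw [h.algorithm_prob]; exact h m e r S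

/-! ### The lottery -/

section lottery

variable {F A} {w : ℝ} {g : ℝ → ℝ} {hg : Measurable g} {P : InputProgram n}

theorem denotes_lottery (hw0 : 0 ≤ w) (hw1 : w ≤ 1) (h0 : ∀ x, 0 ≤ g x) (h1 : ∀ x, g x ≤ 1)
    (hP : P.Denotes F A (P.algorithm F A).prob) (l : List (Fin n)) :
    (lottery w g hg P l).Denotes F A ((lottery w g hg P l).algorithm F A).prob := by
  induction l with
  | nil => exact hP
  | cons i l ih =>
    exact denotes_self_of_denotes (Denotes.coin (fun _ => hw0) (fun _ => hw1)
      (Denotes.coin (fun _ => h0 _) (fun _ => h1 _) (denotes_serve _) (denotes_serve _)) ih)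

theorem lottery_cons_prob (hw0 : 0 ≤ w) (hw1 : w ≤ 1) (h0 : ∀ x, 0 ≤ g x) (h1 : ∀ x, g x ≤ 1)
    (hP : P.Denotes F A (P.algorithm F A).prob) (i : Fin n) (l : List (Fin n)) (v : Fin n → ℝ)
    (S : Finset (Fin n)) :
    ((lottery w g hg P (i :: l)).algorithm F A).prob v S =
      w * (g (v i) * (if {i} = S then 1 else 0) + (1 - g (v i)) * (if ∅ = S then 1 else 0)) +
        (1 - w) * ((lottery w g hg P l).algorithm F A).prob v S :=
  (Denotes.coin (fun _ => hw0) (fun _ => hw1)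
    (Denotes.coin (fun _ => h0 _) (fun _ => h1 _) (denotes_serve _) (denotes_serve _))
    (denotes_lottery hw0 hw1 h0 h1 hP l)).algorithm_prob v S

theorem isFeasible_lottery {feasible : Finset (Finset (Fin n))} (hempty : ∅ ∈ feasible)
    (hsingle : ∀ i, {i} ∈ feasible) (hw0 : 0 ≤ w) (hw1 : w ≤ 1) (h0 : ∀ x, 0 ≤ g x)
    (h1 : ∀ x, g x ≤ 1) (hP : P.Denotes F A (P.algorithm F A).prob)
    (hfeas : (P.algorithm F A).IsFeasible feasible) (l : List (Fin n)) :
    ((lottery w g hg P l).algorithm F A).IsFeasible feasible := by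
  induction l with
  | nil => exact hfeas
  | cons i l ih =>
    intro v S hS
    rw [lottery_cons_prob hw0 hw1 h0 h1 hP, ih v S hS, if_neg (by rintro rfl; exact hS (hsingle i)),
      if_neg (by rintro rfl; exact hS hempty)]
    ring

/-- The coefficient `c` depends on the position of the agent in the list, since the lottery may stop
earlier; the stated lower bound covers every position. It does not depend on `v`, so `g` controls
the shape of the added term. -/
theorem exists_servedProb_lottery (hw0 : 0 ≤ w) (hw1 : w ≤ 1) (h0 : ∀ x, 0 ≤ g x)
    (h1 : ∀ x, g x ≤ 1) (hP : P.Denotes F A (P.algorithm F A).prob) (i : Fin n)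
    (l : List (Fin n)) :
    ∃ c : ℝ, 0 ≤ c ∧ (i ∈ l → w * (1 - w) ^ l.length ≤ c) ∧
      ∀ v, ((lottery w g hg P l).algorithm F A).servedProb i v =
        c * g (v i) + (1 - w) ^ l.length * (P.algorithm F A).servedProb i v := by
  induction l with
  | nil => exact ⟨0, le_rfl, by simp, fun v => by simp [lottery]⟩
  | cons j l ih =>
    obtain ⟨c, hc0, hc, hcv⟩ := ih
    have hpow : (1 - w) ^ l.length ≤ 1 := pow_le_one₀ (by linarith) (by linarith)
    have hpow0 : 0 ≤ (1 - w) ^ l.length := pow_nonneg (by linarith) _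
    have key (v : Fin n → ℝ) : ((lottery w g hg P (j :: l)).algorithm F A).servedProb i v =
        w * (if j = i then g (v i) else 0) +
          (1 - w) * ((lottery w g hg P l).algorithm F A).servedProb i v := by
      simp only [Algorithm.servedProb, lottery_cons_prob hw0 hw1 h0 h1 hP, Finset.sum_add_distrib,
        ← Finset.mul_sum]
      congr 2
      simp only [Finset.sum_ite_eq, Finset.mem_filter, Finset.mem_univ, true_and,
        Finset.mem_singleton, Finset.notMem_empty, if_false]
      by_cases h : j = i
      · subst h; simp
      · simp [h, Ne.symm h]
    refine ⟨w * (if j = i then 1 else 0) + (1 - w) * c, ?_, fun hi => ?_, fun v => ?_⟩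
    · have : (0 : ℝ) ≤ if j = i then 1 else 0 := by split_ifs <;> norm_num
      have := mul_nonneg hw0 this
      have := mul_nonneg (show 0 ≤ 1 - w by linarith) hc0
      linarith
    · rw [List.length_cons, pow_succ]
      by_cases h : j = i
      · simp only [h, if_true, mul_one]
        have e1 : (1 - w) ^ l.length * (1 - w) ≤ 1 := by nlinarith
        have e2 := mul_le_mul_of_nonneg_left e1 hw0
        have e3 := mul_nonneg (show 0 ≤ 1 - w by linarith) hc0
        linarith
      · have := hc ((List.mem_cons.1 hi).resolve_left (Ne.symm h))
        have := mul_le_mul_of_nonneg_left this (show 0 ≤ 1 - w by linarith)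
        simp only [h, if_false]
        linarith
    · rw [key, hcv, List.length_cons, pow_succ]
      by_cases h : j = i
      · simp only [h, if_true]; ring
      · simp only [h, if_false]; ring

theorem exists_interim_lottery (hw0 : 0 ≤ w) (hw1 : w ≤ 1) (h0 : ∀ x, 0 ≤ g x)
    (h1 : ∀ x, g x ≤ 1) (hP : P.Denotes F A (P.algorithm F A).prob) (i : Fin n) :
    ∃ c : ℝ, w * (1 - w) ^ n ≤ c ∧
      ∀ b, ((lottery w g hg P (List.finRange n)).algorithm F A).interim F i b =
        c * g b + (1 - w) ^ n * (P.algorithm F A).interim F i b := by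
  obtain ⟨c, -, hc, hcv⟩ := exists_servedProb_lottery (hg := hg) hw0 hw1 h0 h1 hP i
    (List.finRange n)
  rw [List.length_finRange] at hc hcv
  refine ⟨c, hc (List.mem_finRange i), fun b => ?_⟩
  have hm : Measurable fun v : Fin n → ℝ => Function.update v i b :=
    (measurable_update_prod i).comp (measurable_const.prodMk measurable_id)
  have hint : Integrable (fun v => (P.algorithm F A).servedProb i (Function.update v i b))
      (Measure.pi F) := integrable_of_unit (((P.algorithm F A).measurable_servedProb i).comp hm)
    (fun _ => Algorithm.servedProb_nonneg _ _ _) (fun _ => Algorithm.servedProb_le_one _ _ _)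
  simp only [Algorithm.interim_eq, hcv, Function.update_self]
  rw [integral_add (integrable_const _) (hint.const_mul _),
    integral_const_mul ((1 - w) ^ n)]
  simp

end lottery

/-! ### The ironed algorithm -/

variable (t : ℕ → ℝ) (K s : ℕ)

theorem denotes_ironed (P : Fin n → List (ℕ × ℕ × ℕ)) :
    (ironed t K P).Denotes F A fun v S =>
      ∫ w, A.prob w S ∂(Measure.pi fun j => blockLaw (F j) t K (P j) (v j)) := by
  intro m e r S
  refine (Denotes.resampleCall (fun T => denotes_serve T) m e r S).trans ?_
  simp [blockLaw]

theorem cellProb_le_one (x : Fin n × ℕ × ℕ) : cellProb F A t x ≤ 1 := by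
  calc _ ≤ ∫ _, (1 : ℝ) ∂(sampleLaw (F x.1) (t x.2.1) (t x.2.2)) :=
        integral_mono (A.integrable_interim F _ _) (integrable_const _) (A.interim_le_one F _)
    _ = 1 := by simp

variable {F A t K s}

/-- A query conditions the other agents on `[t 0, t K)`, which has full measure, so each count has
success probability exactly `cellProb`. -/
theorem denotes_estimateAndIron (hsupp : ∀ i, ∀ᵐ x ∂(F i), x ∈ Set.Ico (t 0) (t K)) :
    (estimateAndIron n t K s).Denotes F A fun v S =>
      (ironAgents K (List.finRange n)).expect (cellProb F A t) s fun P =>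
        ((ironed t K P).algorithm F A).prob v S := by
  have := Denotes.ofEstTree (F := F) (A := A) (ag := fun x : Fin n × ℕ × ℕ => x.1)
    (a := fun x => Function.update (fun _ => t 0) x.1 (t x.2.1))
    (b := fun x => Function.update (fun _ => t K) x.1 (t x.2.2)) (s := s)
    (ironAgents K (List.finRange n)) (k := ironed t K)
    (fun P => denotes_self_of_denotes (denotes_ironed F A t K P))
  have e : (fun x : Fin n × ℕ × ℕ => ∫ w, A.servedProb x.1 w ∂(Measure.pi fun j =>
      sampleLaw (F j) (Function.update (fun _ => t 0) x.1 (t x.2.1) j)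
        (Function.update (fun _ => t K) x.1 (t x.2.2) j))) = cellProb F A t := by
    funext x
    rw [cellProb, ← A.integral_servedProb_pi_update F]
    congr 2
    funext j
    by_cases h : j = x.1
    · subst h; simp
    · simp only [Function.update_of_ne h]
      exact sampleLaw_of_ae _ (hsupp j)
  rwa [e] at this

/-- A fixed report is a Dirac marginal for agent `i`; pushing all marginals through their block
kernels gives the product on the right. Nothing is assumed about the stacks, so this also covers
inaccurate estimates. -/
theorem interim_ironed (P : Fin n → List (ℕ × ℕ × ℕ)) (i : Fin n) (b : ℝ) :
    ((ironed t K P).algorithm F A).interim F i b = ∫ w, A.servedProb i w ∂(Measure.pi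
      (Function.update (fun j => (F j).bind (blockLaw (F j) t K (P j))) i
        (blockLaw (F i) t K (P i) b))) := by
  have hserved (v : Fin n → ℝ) : ((ironed t K P).algorithm F A).servedProb i v =
      ∫ w, A.servedProb i w ∂(Measure.pi fun j => blockLaw (F j) t K (P j) (v j)) := by
    simp only [Algorithm.servedProb, (denotes_ironed F A t K P).algorithm_prob]
    rw [integral_finsetSum]
    intro S _
    refine integrable_of_unit (A.measurable S) (fun v => A.nonneg v S) fun v => ?_
    rw [← A.sum_eq_one v]
    exact Finset.single_le_sum (fun T _ => A.nonneg v T) (Finset.mem_univ S)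
  have := isProbabilityMeasure_update F i (Measure.dirac b)
  have h1 := ((ironed t K P).algorithm F A).integral_servedProb_pi_update F i (Measure.dirac b)
  rw [integral_dirac] at h1
  rw [← h1]
  simp only [hserved]
  rw [integral_pi_bind _ _ (fun _ => measurable_blockLaw) (A.measurable_servedProb i)
    (A.servedProb_nonneg i) (A.servedProb_le_one i)]
  congr 2
  funext j
  by_cases h : j = i
  · subst h
    simp only [Function.update_self]
    exact Measure.dirac_bind measurable_blockLaw b
  · simp only [Function.update_of_ne h]

/-- Holds for arbitrary stacks, so within a cell even failed estimates cause no violation of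
monotonicity. -/
theorem interim_ironed_eq_of_level_eq (P : Fin n → List (ℕ × ℕ × ℕ)) (i : Fin n) {b b' : ℝ}
    (h : level t K b = level t K b') : ((ironed t K P).algorithm F A).interim F i b =
      ((ironed t K P).algorithm F A).interim F i b' := by
  simp only [interim_ironed, blockLaw, h]

/-- By `bind_blockLaw` the other agents' redrawn values keep their distributions, so only agent
`i`'s own block matters. -/
theorem interim_ironed_of_isIroned (ht : StrictMono t)
    (hsupp : ∀ i, ∀ᵐ x ∂(F i), x ∈ Set.Ico (t 0) (t K)) {acc : Fin n → ℕ → ℕ → ℕ → Prop}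
    {P : Fin n → List (ℕ × ℕ × ℕ)} (hP : ∀ i, IsIroned (acc i) K (P i)) (i : Fin n) (b : ℝ) :
    ((ironed t K P).algorithm F A).interim F i b =
      ∫ y, A.interim F i y ∂(blockLaw (F i) t K (P i) b) := by
  rw [interim_ironed, ← A.integral_servedProb_pi_update F]
  congr 3
  funext j
  exact bind_blockLaw ht (hP j) (hsupp j)

theorem interim_estimateAndIron (hsupp : ∀ i, ∀ᵐ x ∂(F i), x ∈ Set.Ico (t 0) (t K)) (i : Fin n)
    (b : ℝ) : ((estimateAndIron n t K s).algorithm F A).interim F i b =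
      (ironAgents K (List.finRange n)).expect (cellProb F A t) s fun P =>
        ((ironed t K P).algorithm F A).interim F i b := by
  simp only [Algorithm.interim_eq, Algorithm.servedProb,
    (denotes_estimateAndIron hsupp).algorithm_prob, ← EstTree.expect_sum]
  have hm : Measurable fun v : Fin n → ℝ => Function.update v i b :=
    (measurable_update_prod i).comp (measurable_const.prodMk measurable_id)
  exact EstTree.integral_expect _ fun P => integrable_of_unit
    ((((ironed t K P).algorithm F A).measurable_servedProb i).comp hm)
    (fun _ => Algorithm.servedProb_nonneg _ _ _) (fun _ => Algorithm.servedProb_le_one _ _ _)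

theorem isFeasible_estimateAndIron {feasible : Finset (Finset (Fin n))}
    (hsupp : ∀ i, ∀ᵐ x ∂(F i), x ∈ Set.Ico (t 0) (t K)) (hA : A.IsFeasible feasible) :
    ((estimateAndIron n t K s).algorithm F A).IsFeasible feasible := fun v S hS => by
  simp [(denotes_estimateAndIron hsupp).algorithm_prob,
    (denotes_ironed F A t K _).algorithm_prob, hA _ S hS, EstTree.expect_const]

end

/-! ## Correctness of the reduction -/

/-- All counts come from the same number `s` of trials, so they can be compared directly, and the
two errors of size `η` add up. -/
theorem cellProb_le_of_accurate {n : ℕ} {F : Fin n → Measure ℝ} {A : Algorithm n}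
    {t : ℕ → ℝ} {s : ℕ} {η : ℝ} {x x' : Fin n × ℕ × ℕ} {c c' : ℕ} (hs : 0 < s)
    (h : |(c : ℝ) - s * cellProb F A t x| ≤ s * η)
    (h' : |(c' : ℝ) - s * cellProb F A t x'| ≤ s * η) (hc : c ≤ c') :
    cellProb F A t x ≤ cellProb F A t x' + 2 * η := by
  have hs' : (0 : ℝ) < s := Nat.cast_pos.2 hs
  have hc' : (c : ℝ) ≤ c' := Nat.cast_le.2 hc
  refine le_of_mul_le_mul_left ?_ hs'
  linarith [(abs_le.1 h).1, (abs_le.1 h').2]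

section

variable {n : ℕ} {F : Fin n → Measure ℝ} [∀ i, IsProbabilityMeasure (F i)] {A : Algorithm n}
  {t : ℕ → ℝ} {K s : ℕ} {η p w : ℝ}

theorem ensures_ironAgents_isIroned (ht : StrictMono t) (ht0 : t 0 = 0)
    (hint : ∀ i, Integrable (fun x => x) (F i)) (hpos : ∀ i, ∀ᵐ x ∂(F i), 0 ≤ x) (hs : 0 < s)
    (hη : 0 ≤ η) :
    (ironAgents K (List.finRange n)).Ensures
      (fun x c => |(c : ℝ) - s * cellProb F A t x| ≤ s * η) fun P => ∀ i,
      IsIroned (fun a b c => |(c : ℝ) - s * cellProb F A t (i, a, b)| ≤ s * η) K (P i) ∧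
      ∑ k ∈ Finset.range K, (∫ x in Set.Ico (t k) (t (k + 1)), x ∂(F i)) *
          cellProb F A t (i, k, k + 1) - 2 * η * (∫ x, x ∂(F i)) * K ≤
        stackSum (fun a b => (∫ x in Set.Ico (t a) (t b), x ∂(F i)) * cellProb F A t (i, a, b))
          (P i) := by
  refine (ensures_ironAgents (I := fun i s' =>
      IsIroned (fun a b c => |(c : ℝ) - s * cellProb F A t (i, a, b)| ≤ s * η) K s' ∧
      ∑ k ∈ Finset.range K, (∫ x in Set.Ico (t k) (t (k + 1)), x ∂(F i)) *
          cellProb F A t (i, k, k + 1) - 2 * η * (∫ x, x ∂(F i)) * K ≤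
        stackSum (fun a b => (∫ x in Set.Ico (t a) (t b), x ∂(F i)) * cellProb F A t (i, a, b)) s')
    (fun i => ?_) (List.finRange n)).mono fun P hP i => hP i (List.mem_finRange i)
  refine (ensures_ironCells (Q := fun a b => cellProb F A t (i, a, b)) (d := 2 * η)
    (V := fun a b => ∫ x in Set.Ico (t a) (t b), x ∂(F i)) (M := 2 * η * ∫ x, x ∂(F i))
    (fun a b a' b' c c' h h' hc => cellProb_le_of_accurate hs h h' hc)
    (fun a b c hab hbc hle => merge_le ht ht0 (A.measurable_interim F i) (A.interim_nonneg F i)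
      (A.interim_le_one F i) (hint i) (hpos i) (by linarith) hab hbc hle) K).mono
    fun s' hs' => ⟨hs'.1, hs'.2.trans ?_⟩
  have : 0 ≤ ∫ x, x ∂(F i) := integral_nonneg_of_ae (hpos i)
  have : 0 ≤ 2 * η * (∫ x, x ∂(F i)) * s'.length := by positivity
  linarith

theorem cellWeight_nonneg (x : ℝ) : 0 ≤ cellWeight t K x := by
  unfold cellWeight; positivity

theorem half_le_cellWeight (x : ℝ) : 1 / 2 ≤ cellWeight t K x := by
  unfold cellWeight
  have : (0 : ℝ) ≤ level t K x / (2 * K) := by positivity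
  linarith

theorem cellWeight_le_one (x : ℝ) : cellWeight t K x ≤ 1 := by
  have h : (level t K x : ℝ) ≤ K := Nat.cast_le.2 (level_le x)
  have : (level t K x : ℝ) / (2 * K) = level t K x / K / 2 := by rw [mul_comm, div_div]
  have := div_le_one_of_le₀ h (Nat.cast_nonneg K)
  unfold cellWeight
  linarith

theorem denotes_estimateAndIron_self (hsupp : ∀ i, ∀ᵐ x ∂(F i), x ∈ Set.Ico (t 0) (t K)) :
    (estimateAndIron n t K s).Denotes F A ((estimateAndIron n t K s).algorithm F A).prob :=
  denotes_self_of_denotes (denotes_estimateAndIron hsupp)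

/-- Ironing according to estimates is monotone, up to a small error. -/
theorem interim_estimateAndIron_le (ht : StrictMono t) (ht0 : t 0 = 0)
    (hsupp : ∀ i, ∀ᵐ x ∂(F i), x ∈ Set.Ico (t 0) (t K))
    (hint : ∀ i, Integrable (fun x => x) (F i)) (hpos : ∀ i, ∀ᵐ x ∂(F i), 0 ≤ x) (hs : 0 < s)
    (hη : 0 ≤ η) (hη' : η ≤ 1 / 2) (hp : 2 * Real.exp (-(s * η ^ 2 / 4)) ≤ p) (hp1 : p ≤ 1)
    {b b' : ℝ} (hb : b ≤ b') (hb' : b' ∈ Set.Ico (t 0) (t K)) (i : Fin n) :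
    ((estimateAndIron n t K s).algorithm F A).interim F i b ≤
      ((estimateAndIron n t K s).algorithm F A).interim F i b' + (2 * η + n * (2 * K) * p) := by
  have hp0 : 0 ≤ p := le_trans (by positivity) hp
  set N : ℕ := (List.finRange n).length * (2 * K)
  have hN : (N : ℝ) = n * (2 * K) := by simp [N]
  -- The difference of the interim probabilities is shifted by `1` to be nonnegative, as required
  -- when the inaccurate branches are dropped.
  have h := EstTree.le_expect_of_ensures (q := cellProb F A t) (s := s) (L := 1 - 2 * η)
    (cellProb_nonneg F A t) (cellProb_le_one F A t) hη (by linarith) hp hp1 (by linarith)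
    (f := fun P => 1 + (((ironed t K P).algorithm F A).interim F i b' +
      -1 * ((ironed t K P).algorithm F A).interim F i b))
    (fun P => by
      have := ((ironed t K P).algorithm F A).interim_nonneg F i b'
      have := ((ironed t K P).algorithm F A).interim_le_one F i b
      linarith)
    (budget_ironAgents K (List.finRange n))
    ((ensures_ironAgents_isIroned ht ht0 hint hpos hs hη).mono fun P hP => by
      have hP' := fun i => (hP i).1
      rw [interim_ironed_of_isIroned ht hsupp hP', interim_ironed_of_isIroned ht hsupp hP']
      have := blockOf_mono (Q := fun a b => cellProb F A t (i, a, b)) (d := 2 * η) (by linarith)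
        (fun a b a' b' c c' h h' hc => cellProb_le_of_accurate hs h h' hc) (hP' i)
        (level_mono hb) (level_lt ht le_rfl hb')
      simp only [cellProb] at this
      simp only [blockLaw]
      linarith)
  rw [EstTree.expect_add, EstTree.expect_add, EstTree.expect_const_mul, EstTree.expect_const,
    ← interim_estimateAndIron hsupp, ← interim_estimateAndIron hsupp, hN] at h
  have : 0 ≤ 2 * η * (n * (2 * K) * p) := by positivity
  linarith

/-- The lottery makes up for the errors of the estimates. -/
theorem interim_reduction_mono (ht : StrictMono t) (ht0 : t 0 = 0)
    (hsupp : ∀ i, ∀ᵐ x ∂(F i), x ∈ Set.Ico (t 0) (t K))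
    (hint : ∀ i, Integrable (fun x => x) (F i)) (hpos : ∀ i, ∀ᵐ x ∂(F i), 0 ≤ x) (hs : 0 < s)
    (hη : 0 ≤ η) (hη' : η ≤ 1 / 2) (hp : 2 * Real.exp (-(s * η ^ 2 / 4)) ≤ p) (hp1 : p ≤ 1)
    (hw0 : 0 ≤ w) (hw1 : w ≤ 1) (hK : 0 < K) (hslope : 2 * η + n * (2 * K) * p ≤ w / (2 * K))
    {b b' : ℝ} (hb : b ≤ b') (hb' : b' ∈ Set.Ico (t 0) (t K)) (i : Fin n) :
    ((reduction n t K s w).algorithm F A).interim F i b ≤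
      ((reduction n t K s w).algorithm F A).interim F i b' := by
  obtain ⟨c, hc, hcv⟩ := exists_interim_lottery (hg := measurable_cellWeight t K) hw0 hw1
    cellWeight_nonneg cellWeight_le_one (denotes_estimateAndIron_self (F := F) (A := A) (s := s)
      hsupp) i
  simp only [reduction, hcv]
  have hw : 0 ≤ (1 - w) ^ n := pow_nonneg (by linarith) _
  -- In the same cell the ironed parts agree exactly. In different cells the lottery gains at least
  -- `c / (2 * K)`, which covers the estimation error by `hslope`.
  rcases (level_mono (t := t) (K := K) hb).eq_or_lt with h | h
  · have e : ((estimateAndIron n t K s).algorithm F A).interim F i b =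
        ((estimateAndIron n t K s).algorithm F A).interim F i b' := by
      rw [interim_estimateAndIron hsupp, interim_estimateAndIron hsupp]
      simp only [interim_ironed_eq_of_level_eq _ i h]
    rw [e, cellWeight, cellWeight, h]
  · have hK' : (0 : ℝ) < K := Nat.cast_pos.2 hK
    have h1 : cellWeight t K b + 1 / (2 * K) ≤ cellWeight t K b' := by
      have : (level t K b : ℝ) + 1 ≤ level t K b' := by exact_mod_cast h
      have := div_le_div_of_nonneg_right this (show 0 ≤ 2 * (K : ℝ) by positivity)
      rw [add_div] at this
      unfold cellWeight
      linarith
    have hc0 : 0 ≤ c := le_trans (mul_nonneg hw0 hw) hc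
    have h2 := mul_le_mul_of_nonneg_left h1 hc0
    have h3 := mul_le_mul_of_nonneg_left (interim_estimateAndIron_le (A := A) ht ht0 hsupp hint hpos
      hs hη hη' hp hp1 hb hb' i) hw
    have h4 := mul_le_mul_of_nonneg_left hslope hw
    have h5 := div_le_div_of_nonneg_right hc (show 0 ≤ 2 * (K : ℝ) by positivity)
    have e1 : w * (1 - w) ^ n / (2 * K) = (1 - w) ^ n * (w / (2 * K)) := by ring
    have e2 : c * (cellWeight t K b + 1 / (2 * K)) = c * cellWeight t K b + c / (2 * K) := by ring
    linarith

theorem welfare_nonneg (B : Algorithm n) (hint : ∀ i, Integrable (fun x => x) (F i))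
    (hpos : ∀ i, ∀ᵐ x ∂(F i), 0 ≤ x) : 0 ≤ B.welfare F := by
  rw [B.welfare_eq_sum_interim F hint]
  exact Finset.sum_nonneg fun i _ => integral_nonneg_of_ae ((hpos i).mono fun x hx =>
    mul_nonneg hx (B.interim_nonneg F i x))

theorem welfare_estimateAndIron (hsupp : ∀ i, ∀ᵐ x ∂(F i), x ∈ Set.Ico (t 0) (t K))
    (hint : ∀ i, Integrable (fun x => x) (F i)) :
    ((estimateAndIron n t K s).algorithm F A).welfare F =
      (ironAgents K (List.finRange n)).expect (cellProb F A t) s fun P =>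
        ((ironed t K P).algorithm F A).welfare F := by
  simp only [Algorithm.welfare_eq_sum_interim _ F hint]
  rw [EstTree.expect_sum]
  refine Finset.sum_congr rfl fun i _ => ?_
  simp only [interim_estimateAndIron hsupp, ← EstTree.expect_const_mul]
  exact EstTree.integral_expect _ fun P => Algorithm.integrable_mul_interim _ F (hint i)

/-- When all estimates are accurate, agent `i` loses the factor `r` and at most `t 1` to the grid,
and `2 * η` times its mean for each of at most `K` merges. The factor in front of the bound accounts
for inaccurate estimates. -/
theorem le_welfare_estimateAndIron (ht : StrictMono t) (ht0 : t 0 = 0) {r : ℝ} (hr : 1 ≤ r)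
    (htr : ∀ k, t (k + 2) ≤ r * t (k + 1))
    (hsupp : ∀ i, ∀ᵐ x ∂(F i), x ∈ Set.Ico (t 0) (t K))
    (hint : ∀ i, Integrable (fun x => x) (F i)) (hpos : ∀ i, ∀ᵐ x ∂(F i), 0 ≤ x) (hs : 0 < s)
    (hη : 0 ≤ η) (hη' : η ≤ 1) (hp : 2 * Real.exp (-(s * η ^ 2 / 4)) ≤ p) (hp1 : p ≤ 1)
    {L : ℝ} (hL : 0 ≤ L)
    (hL' : r * (L + 2 * η * K * ∑ i, ∫ x, x ∂(F i)) ≤ A.welfare F - n * t 1) :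
    L * (1 - n * (2 * K) * p) ≤ ((estimateAndIron n t K s).algorithm F A).welfare F := by
  have hN : (((List.finRange n).length * (2 * K) : ℕ) : ℝ) = n * (2 * K) := by simp
  rw [welfare_estimateAndIron hsupp hint, ← hN]
  refine EstTree.le_expect_of_ensures (q := cellProb F A t) (s := s)
    (cellProb_nonneg F A t) (cellProb_le_one F A t) hη hη' hp hp1 hL
    (fun P => welfare_nonneg _ hint hpos) (budget_ironAgents K (List.finRange n))
    ((ensures_ironAgents_isIroned ht ht0 hint hpos hs hη).mono fun P hP => ?_)
  have hP' := fun i => (hP i).1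
  refine le_of_mul_le_mul_left ?_ (show 0 < r by linarith)
  rw [Algorithm.welfare_eq_sum_interim _ F hint]
  simp only [interim_ironed_of_isIroned ht hsupp hP']
  have hi (i : Fin n) : (∫ x, x * A.interim F i x ∂(F i)) - t 1 ≤
      r * ((∫ x, x * ∫ y, A.interim F i y ∂(blockLaw (F i) t K (P i) x) ∂(F i)) +
        2 * η * (∫ x, x ∂(F i)) * K) := by
    have h1 := le_sum_cells ht ht0 hr htr (A.measurable_interim F i) (A.interim_nonneg F i)
      (A.interim_le_one F i) (hint i) K
    rw [Measure.restrict_eq_self_of_ae_mem (hsupp i)] at h1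
    refine h1.trans (mul_le_mul_of_nonneg_left ?_ (by linarith))
    rw [integral_mul_blockLaw ht (hP' i) (A.measurable_interim F i) (A.interim_nonneg F i)
      (A.interim_le_one F i) (hsupp i) (hint i)]
    have := (hP i).2
    simp only [cellProb] at this
    linarith
  have hsum := Finset.sum_le_sum fun i (_ : i ∈ Finset.univ) => hi i
  rw [Finset.sum_sub_distrib, ← A.welfare_eq_sum_interim F hint, ← Finset.mul_sum,
    Finset.sum_add_distrib, ← Finset.sum_mul, ← Finset.mul_sum, Finset.sum_const,
    Finset.card_univ, Fintype.card_fin, nsmul_eq_mul] at hsum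
  linarith

/-- The lottery is worth `w / 2 * M` up to the factor `(1 - w) ^ n`. One half of it pays for the
first cells (`ht1`), the other for the merges (`hslope`). Only multiplicative losses remain, and
`hloss` bounds those. -/
theorem welfare_le_welfare_reduction (ht : StrictMono t) (ht0 : t 0 = 0) {r ε : ℝ} (hr : 1 ≤ r)
    (htr : ∀ k, t (k + 2) ≤ r * t (k + 1))
    (hsupp : ∀ i, ∀ᵐ x ∂(F i), x ∈ Set.Ico (t 0) (t K))
    (hint : ∀ i, Integrable (fun x => x) (F i)) (hpos : ∀ i, ∀ᵐ x ∂(F i), 0 ≤ x) (hs : 0 < s)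
    (hη : 0 ≤ η) (hη' : η ≤ 1) (hp : 2 * Real.exp (-(s * η ^ 2 / 4)) ≤ p) (hp1 : p ≤ 1)
    (hw0 : 0 ≤ w) (hw1 : w ≤ 1) (hslope : 2 * η * K ≤ w / 4)
    (ht1 : n * t 1 ≤ w / 4 * ∑ i, ∫ x, x ∂(F i)) (hε : 0 ≤ ε)
    (hloss : r ≤ (1 + ε) * (1 - n * w - n * (2 * K) * p)) :
    A.welfare F ≤ (1 + ε) * ((reduction n t K s w).algorithm F A).welfare F := by
  set M := ∑ i, ∫ x, x ∂(F i)
  set W := A.welfare F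
  set B := (estimateAndIron n t K s).algorithm F A
  set e := (n : ℝ) * (2 * K) * p
  have hp0 : 0 ≤ p := le_trans (by positivity) hp
  have he0 : 0 ≤ e := by positivity
  have hM : 0 ≤ M := Finset.sum_nonneg fun i _ => integral_nonneg_of_ae (hpos i)
  have hW : 0 ≤ W := welfare_nonneg A hint hpos
  have hpow : 0 ≤ (1 - w) ^ n := pow_nonneg (by linarith) _
  have hlow : (1 - w) ^ n * (w / 2 * M + B.welfare F) ≤
      ((reduction n t K s w).algorithm F A).welfare F := by
    rw [B.welfare_eq_sum_interim F hint, Algorithm.welfare_eq_sum_interim _ F hint, Finset.mul_sum,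
      ← Finset.sum_add_distrib, Finset.mul_sum]
    refine Finset.sum_le_sum fun i _ => ?_
    obtain ⟨c, hc, hcv⟩ := exists_interim_lottery (hg := measurable_cellWeight t K) hw0 hw1
      cellWeight_nonneg cellWeight_le_one (denotes_estimateAndIron_self (F := F) (A := A) (s := s)
        hsupp) i
    have h1 : ∀ᵐ x ∂(F i), (1 - w) ^ n * (w / 2 * x + x * B.interim F i x) ≤
        x * ((reduction n t K s w).algorithm F A).interim F i x := by
      filter_upwards [hpos i] with x hx
      simp only [reduction, hcv]
      have h2 : w * (1 - w) ^ n * (1 / 2) ≤ c * cellWeight t K x :=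
        mul_le_mul hc (half_le_cellWeight x) (by norm_num) (le_trans (mul_nonneg hw0 hpow) hc)
      have h3 := mul_le_mul_of_nonneg_left h2 hx
      simp only [B]
      linarith
    have hB := B.integrable_mul_interim F (i := i) (hint i)
    have h4 := integral_mono_ae (((hint i).const_mul (w / 2)).add hB |>.const_mul ((1 - w) ^ n))
      (Algorithm.integrable_mul_interim _ F (hint i)) h1
    simp only [Pi.add_apply] at h4
    rwa [integral_const_mul, integral_add ((hint i).const_mul _) hB, integral_const_mul] at h4
  have hbern : 1 - n * w ≤ (1 - w) ^ n := by
    have := one_add_mul_le_pow (show -2 ≤ -w by linarith) n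
    rw [← sub_eq_add_neg] at this
    linarith
  have hpos' : 0 < 1 - n * w - e := by
    by_contra hcon
    have := mul_nonneg (show 0 ≤ 1 + ε by linarith) (show 0 ≤ -(1 - n * w - e) by linarith)
    linarith
  have hnw : 0 ≤ n * w := by positivity
  have hB : (1 - e) * W ≤ r * (w / 2 * M + B.welfare F) := by
    have hBnn : 0 ≤ B.welfare F := welfare_nonneg B hint hpos
    have hKM := mul_le_mul_of_nonneg_right hslope hM
    -- The welfare that is left for the ironed algorithm after all additive losses; it may be
    -- negative.
    set L := (W - n * t 1) / r - 2 * η * K * M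
    have hrL : r * (L + 2 * η * K * M) = W - n * t 1 := by
      simp only [L, sub_add_cancel]
      field_simp
    have hWle : W ≤ r * (w / 2 * M + L) := by
      have h1 : n * t 1 ≤ r * (w / 4 * M) := by
        refine ht1.trans (le_mul_of_one_le_left (by positivity) hr)
      have h2 := mul_le_mul_of_nonneg_left hKM (show 0 ≤ r by linarith)
      linarith
    -- If `L` is negative, `W` is so small that the lottery alone makes up for it.
    rcases le_total 0 L with hL | hL
    · have h1 := le_welfare_estimateAndIron (L := L) (A := A) ht ht0 hr htr hsupp hint hpos hs hη
        hη' hp hp1 hL hrL.le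
      have h2 : (1 - e) * W ≤ (1 - e) * (r * (w / 2 * M + L)) :=
        mul_le_mul_of_nonneg_left hWle (by linarith)
      have h3 := mul_le_mul_of_nonneg_left h1 (show 0 ≤ r by linarith)
      have h4 : 0 ≤ e * (r * (w / 2 * M)) := by positivity
      linarith
    · have h1 : r * L ≤ 0 := mul_nonpos_of_nonneg_of_nonpos (by linarith) hL
      have h2 : 0 ≤ e * W := by positivity
      have h3 : 0 ≤ r * B.welfare F := by positivity
      linarith
  have hX : 0 ≤ w / 2 * M + B.welfare F := by
    have := welfare_nonneg B hint hpos
    positivity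
  refine le_trans ?_ (mul_le_mul_of_nonneg_left hlow (by linarith))
  set X := w / 2 * M + B.welfare F
  have h1 : r * W ≤ (1 + ε) * ((1 - n * w) * ((1 - e) * W)) := by
    have : (1 - n * w - e) ≤ (1 - n * w) * (1 - e) := by nlinarith [mul_nonneg hnw he0]
    have := mul_le_mul_of_nonneg_left this (show 0 ≤ 1 + ε by linarith)
    have := mul_le_mul_of_nonneg_right (hloss.trans this) hW
    linarith
  have h2 : (1 - n * w) * ((1 - e) * W) ≤ (1 - w) ^ n * (r * X) :=
    mul_le_mul hbern hB (mul_nonneg (by linarith) hW) hpow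
  have h3 := mul_le_mul_of_nonneg_left h2 (show 0 ≤ 1 + ε by linarith)
  refine le_of_mul_le_mul_left ?_ (show 0 < r by linarith)
  linarith

end

/-! ## Payments -/

/-- Myerson's payment `b * x b - ∫₀ᵇ x`, charged as a function of the own report only. Truthfulness
reduces to comparing the rectangle `(t - b) * x b` with the integral of the monotone function `x`
from `b` to `t`. -/
theorem Algorithm.IsMonotone.isBIC {n : ℕ} {A : Algorithm n} {F : Fin n → Measure ℝ}
    [∀ i, IsProbabilityMeasure (F i)] {vmax : ℝ} (h : A.IsMonotone F vmax) : A.IsBIC F vmax := by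
  refine ⟨fun v i => v i * A.interim F i (v i) - ∫ z in (0 : ℝ)..(v i), A.interim F i z,
    fun i b _ => by simp, fun i t ht b hb => ?_⟩
  simp only [Function.update_self, integral_const, probReal_univ, one_smul]
  have hint (x y : ℝ) : IntervalIntegrable (A.interim F i) volume x y := by
    have : IsFiniteMeasure (volume.restrict (Set.uIoc x y)) := ⟨by simp [Set.uIoc]⟩
    exact intervalIntegrable_iff.2 (A.integrable_interim F i _)
  have hsplit := intervalIntegral.integral_add_adjacent_intervals (hint 0 b) (hint b t)
  have key : (t - b) * A.interim F i b ≤ ∫ z in b..t, A.interim F i z := by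
    rcases le_total b t with hbt | hbt
    · have := intervalIntegral.integral_mono_on hbt intervalIntegrable_const (hint b t)
        fun x hx => h i hb ⟨hb.1.trans hx.1, hx.2.trans ht.2⟩ hx.1
      simpa using this
    · have := intervalIntegral.integral_mono_on hbt (hint t b) intervalIntegrable_const
        fun x hx => h i ⟨ht.1.trans hx.1, hx.2.trans hb.2⟩ hb hx.2
      rw [intervalIntegral.integral_symm]
      rw [intervalIntegral.integral_const, smul_eq_mul] at this
      linarith
  linarith

/-! ## Choice of the parameters -/

/-- The grid `0, a, a * r, a * r ^ 2, …`. -/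
def geometricGrid (a r : ℝ) : ℕ → ℝ
  | 0 => 0
  | k + 1 => a * r ^ k

theorem strictMono_geometricGrid {a r : ℝ} (ha : 0 < a) (hr : 1 < r) :
    StrictMono (geometricGrid a r) := by
  refine strictMono_nat_of_lt_succ fun k => ?_
  cases k with
  | zero => simpa [geometricGrid]
  | succ k => exact mul_lt_mul_of_pos_left (pow_lt_pow_right₀ hr (Nat.lt_succ_self k)) ha

/-- The probability with which the lottery stops at each agent. -/
noncomputable def lotteryProb (n : ℕ) (e : ℝ) : ℝ := e / (8 * n)

/-- The length of the first grid cell. -/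
noncomputable def firstCell (n : ℕ) (e μ : ℝ) : ℝ := lotteryProb n e * μ / (4 * n)

/-- The number of grid cells. -/
noncomputable def numCells (n : ℕ) (e vmax μ : ℝ) : ℕ :=
  -- One of the two extra cells is the initial one, starting at `0`; the other puts the last grid
  -- point strictly above `vmax`, as half-open cells demand.
  ⌈8 / e * Real.log (vmax / firstCell n e μ)⌉₊ + 2

/-- The accuracy of the estimates. -/
noncomputable def accuracy (n : ℕ) (e vmax μ : ℝ) : ℝ := lotteryProb n e / (8 * numCells n e vmax μ)

/-- The probability with which an estimate may be inaccurate. -/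
noncomputable def failureProb (n : ℕ) (e vmax μ : ℝ) : ℝ :=
  -- Chosen so that `2 * n * K * p = w / (4 * K)`, the same share of the lottery's slope as `2 * η`.
  lotteryProb n e / (8 * n * numCells n e vmax μ ^ 2)

/-- The number of calls to the algorithm oracle per estimate. -/
noncomputable def numTrials (n : ℕ) (e vmax μ : ℝ) : ℕ :=
  ⌈4 * ((accuracy n e vmax μ) ^ 2)⁻¹ * Real.log (2 / failureProb n e vmax μ)⌉₊ + 1

/-- The reduction for the accuracy parameter `e ≤ 1 / 2`. -/
noncomputable def mechanism (n : ℕ) (e vmax μ : ℝ) : InputProgram n :=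
  reduction n (geometricGrid (firstCell n e μ) (1 + e / 4)) (numCells n e vmax μ)
    (numTrials n e vmax μ) (lotteryProb n e)

/-! ### Inequalities between the parameters -/

section parameters

variable {n : ℕ} {e vmax μ : ℝ}

theorem lotteryProb_pos (hn : 1 ≤ n) (he : 0 < e) : 0 < lotteryProb n e := by
  have : (0 : ℝ) < n := by exact_mod_cast hn
  unfold lotteryProb; positivity

theorem lotteryProb_le (hn : 1 ≤ n) (he : 0 < e) : lotteryProb n e ≤ e / 8 := by
  have : (1 : ℝ) ≤ n := by exact_mod_cast hn
  unfold lotteryProb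
  exact div_le_div_of_nonneg_left he.le (by norm_num) (by linarith)

theorem firstCell_pos (hn : 1 ≤ n) (he : 0 < e) (hμ : 0 < μ) : 0 < firstCell n e μ := by
  have : (0 : ℝ) < n := by exact_mod_cast hn
  have := lotteryProb_pos hn he
  unfold firstCell; positivity

theorem two_le_numCells : (2 : ℝ) ≤ numCells n e vmax μ := by
  unfold numCells; push_cast; linarith [Nat.cast_nonneg (α := ℝ)
    ⌈8 / e * Real.log (vmax / firstCell n e μ)⌉₊]

theorem lt_geometricGrid_numCells (hn : 1 ≤ n) (he : 0 < e) (he' : e ≤ 1 / 2) (hv : 0 < vmax)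
    (hμ : 0 < μ) :
    vmax < geometricGrid (firstCell n e μ) (1 + e / 4) (numCells n e vmax μ) := by
  have ha := firstCell_pos hn he hμ
  set J := ⌈8 / e * Real.log (vmax / firstCell n e μ)⌉₊ + 1
  have hr : 0 < 1 + e / 4 := by linarith
  -- From `log r ≥ 1 - 1 / r` and `e / 4 ≤ 1`; this is the source of the `8 / e` in `numCells`.
  have hlog : e / 8 ≤ Real.log (1 + e / 4) := by
    refine le_trans ?_ (Real.one_sub_inv_le_log_of_pos hr)
    have e1 : 1 - (1 + e / 4)⁻¹ = e / 4 / (1 + e / 4) := by field_simp; ring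
    rw [e1, div_le_div_iff₀ (by norm_num) hr]
    nlinarith
  have hJ : 8 / e * Real.log (vmax / firstCell n e μ) < J := by
    simp only [J]; push_cast
    linarith [Nat.le_ceil (8 / e * Real.log (vmax / firstCell n e μ))]
  have h1 : Real.log (vmax / firstCell n e μ) < J * Real.log (1 + e / 4) := by
    have h2 := mul_lt_mul_of_pos_left hJ (show 0 < e / 8 by positivity)
    have e1 : e / 8 * (8 / e * Real.log (vmax / firstCell n e μ)) =
        Real.log (vmax / firstCell n e μ) := by field_simp
    rw [e1, mul_comm] at h2
    exact h2.trans_le (mul_le_mul_of_nonneg_left hlog (Nat.cast_nonneg J))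
  rw [← Real.log_pow, Real.log_lt_log_iff (by positivity) (by positivity), div_lt_iff₀ ha,
    mul_comm] at h1
  exact h1

theorem accuracy_pos (hn : 1 ≤ n) (he : 0 < e) : 0 < accuracy n e vmax μ := by
  have := lotteryProb_pos hn he
  have := two_le_numCells (n := n) (e := e) (vmax := vmax) (μ := μ)
  unfold accuracy; positivity

theorem failureProb_pos (hn : 1 ≤ n) (he : 0 < e) : 0 < failureProb n e vmax μ := by
  have : (0 : ℝ) < n := by exact_mod_cast hn
  have := lotteryProb_pos hn he
  have := two_le_numCells (n := n) (e := e) (vmax := vmax) (μ := μ)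
  unfold failureProb; positivity

theorem exp_numTrials_le (hn : 1 ≤ n) (he : 0 < e) :
    2 * Real.exp (-(numTrials n e vmax μ * accuracy n e vmax μ ^ 2 / 4)) ≤
      failureProb n e vmax μ := by
  have hη := accuracy_pos (vmax := vmax) (μ := μ) hn he
  have hp := failureProb_pos (vmax := vmax) (μ := μ) hn he
  set η := accuracy n e vmax μ
  set p := failureProb n e vmax μ
  have hs : 4 * (η ^ 2)⁻¹ * Real.log (2 / p) ≤ numTrials n e vmax μ := by
    unfold numTrials; push_cast
    linarith [Nat.le_ceil (4 * (η ^ 2)⁻¹ * Real.log (2 / p))]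
  have h1 : Real.log (2 / p) ≤ numTrials n e vmax μ * η ^ 2 / 4 := by
    have := mul_le_mul_of_nonneg_right hs (show 0 ≤ η ^ 2 / 4 by positivity)
    have e1 : 4 * (η ^ 2)⁻¹ * Real.log (2 / p) * (η ^ 2 / 4) = Real.log (2 / p) := by field_simp
    linarith
  have h2 : Real.exp (-(numTrials n e vmax μ * η ^ 2 / 4)) ≤ Real.exp (-Real.log (2 / p)) :=
    Real.exp_le_exp.2 (neg_le_neg h1)
  rw [← Real.log_inv, Real.exp_log (by positivity), inv_div] at h2
  linarith

end parameters

/-! ## Running time -/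

/-- Up to constants, `n * K * s` is `n³ e⁻² ℓ K³`, and inserting the bound on `K` yields `e⁻⁵ L³
ℓ⁴`. The constants are `475138 = 475136 + 2`, absorbing the additive `2`, `421875 = 75 ^ 3`, and `3`
for `1 + 2 * x ≤ 3 * x`. -/
theorem calls_le_of_params {n : ℕ} {e L ℓ K : ℝ} {s : ℕ} (hn : 1 ≤ n) (he : 0 < e) (he' : e ≤ 1 / 2)
    (hℓ : 1 ≤ ℓ) (hK1 : 1 ≤ K) (hK : K ≤ 75 * (ℓ * L / e))
    (hs : (s : ℝ) ≤ 475136 * ((n : ℝ) ^ 2 * K ^ 2 / e ^ 2 * ℓ) + 2) :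
    1 + n * (2 * K) * s ≤
      3 * 475138 * 421875 * ((n : ℝ) ^ 5 * (e ^ 5)⁻¹ * L ^ 3) * ℓ ^ 4 := by
  have hn' : (1 : ℝ) ≤ n := by exact_mod_cast hn
  have hnK : 1 ≤ n * K := one_le_mul_of_one_le_of_one_le hn' hK1
  have hX : 1 ≤ (n : ℝ) ^ 2 * K ^ 2 / e ^ 2 * ℓ := by
    rw [← mul_pow, ← div_pow]
    have : 1 ≤ n * K / e := by rw [le_div_iff₀ he]; linarith
    exact one_le_mul_of_one_le_of_one_le (one_le_pow₀ this) hℓ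
  have hs' : (s : ℝ) ≤ 475138 * ((n : ℝ) ^ 2 * K ^ 2 / e ^ 2 * ℓ) := by linarith
  calc 1 + n * (2 * K) * s
      ≤ n * K * (475138 * ((n : ℝ) ^ 2 * K ^ 2 / e ^ 2 * ℓ)) +
          2 * (n * K * (475138 * ((n : ℝ) ^ 2 * K ^ 2 / e ^ 2 * ℓ))) := by
        have h1 := mul_le_mul_of_nonneg_left hs' (show 0 ≤ n * K by linarith)
        have h2 : 1 ≤ n * K * (475138 * ((n : ℝ) ^ 2 * K ^ 2 / e ^ 2 * ℓ)) :=
          one_le_mul_of_one_le_of_one_le hnK (by linarith)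
        linarith
    _ = 3 * 475138 * ((n : ℝ) ^ 3 * (e ^ 2)⁻¹ * ℓ * K ^ 3) := by field_simp; ring
    _ ≤ 3 * 475138 * ((n : ℝ) ^ 5 * (e ^ 2)⁻¹ * ℓ * (75 * (ℓ * L / e)) ^ 3) := by
        have : (n : ℝ) ^ 3 ≤ n ^ 5 := pow_le_pow_right₀ hn' (by norm_num)
        gcongr
    _ = _ := by field_simp; ring

/-- Lets one `log f` dominate every logarithm that occurs. The bounds use `e⁻¹ ≥ 2` and `L ≥ log 2`;
the value `10` ensures `log f ≥ 1`. -/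
theorem params_le_runtimeScale {n : ℕ} {e L f : ℝ} (hn : 1 ≤ n) (he : 0 < e) (he' : e ≤ 1 / 2)
    (hL : 0.69 ≤ L) (hf : f = (n : ℝ) ^ 5 * (e ^ 5)⁻¹ * L ^ 3) :
    10 ≤ f ∧ n ≤ f ∧ e⁻¹ ≤ f ∧ L ≤ f := by
  have hn' : (1 : ℝ) ≤ n := by exact_mod_cast hn
  have hn5 : (n : ℝ) ≤ n ^ 5 := le_self_pow₀ hn' (by norm_num)
  have hn51 : (1 : ℝ) ≤ n ^ 5 := one_le_pow₀ hn'
  have hei : 2 ≤ e⁻¹ := by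
    rw [le_inv_comm₀ two_pos he]; linarith
  have he4 : 16 * e⁻¹ ≤ e⁻¹ ^ 5 := by
    have : (2 : ℝ) ^ 4 ≤ e⁻¹ ^ 4 := pow_le_pow_left₀ (by norm_num) hei 4
    nlinarith
  have hL3 : 0.328 ≤ L ^ 3 := by
    have := pow_le_pow_left₀ (by norm_num : (0 : ℝ) ≤ 0.69) hL 3
    norm_num at this ⊢; linarith
  have hL2 : 0.4 ≤ L ^ 2 := by
    have := pow_le_pow_left₀ (by norm_num : (0 : ℝ) ≤ 0.69) hL 2
    norm_num at this ⊢; linarith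
  have hL31 : 0.4 * L ≤ L ^ 3 := by
    have := mul_le_mul_of_nonneg_right hL2 (show 0 ≤ L by linarith)
    linarith
  have hff : f = n ^ 5 * (e⁻¹ ^ 5 * L ^ 3) := by rw [hf, inv_pow]; ring
  have h1 : 5 * e⁻¹ ≤ e⁻¹ ^ 5 * L ^ 3 := by nlinarith
  have h2 : 12 * L ≤ e⁻¹ ^ 5 * L ^ 3 := by nlinarith
  have hpos : 0 ≤ e⁻¹ ^ 5 * L ^ 3 := by linarith
  have h3 : e⁻¹ ^ 5 * L ^ 3 ≤ f := by rw [hff]; exact le_mul_of_one_le_left hpos hn51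
  refine ⟨by linarith, ?_, by linarith, by linarith⟩
  rw [hff]
  exact hn5.trans (le_mul_of_one_le_right (by linarith) (by linarith))

section runtime

variable {n : ℕ} {e vmax μ : ℝ}

theorem log_div_ge (he : 0 < e) (he' : e ≤ 1 / 2) (hμ : 0 < μ) (hv : μ ≤ vmax) :
    Real.log 2 ≤ Real.log (vmax / (e * μ)) := by
  refine Real.log_le_log two_pos ?_
  rw [le_div_iff₀ (by positivity)]
  nlinarith

/-- The logarithm in `numCells` is `5 log 2 + 2 log n + L`, whose terms are at most `5`, `3` and `1`
times `ℓ * L`. Multiplying by `8 / e` gives `72`, and rounding with the two extra cells adds `3`. -/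
theorem numCells_le (hn : 1 ≤ n) (he : 0 < e) (he' : e ≤ 1 / 2) (hμ : 0 < μ) (hv : μ ≤ vmax)
    {ℓ : ℝ} (hℓ : 1 ≤ ℓ) (hnℓ : Real.log n ≤ ℓ) :
    (numCells n e vmax μ : ℝ) ≤ 75 * (ℓ * Real.log (vmax / (e * μ)) / e) := by
  have hn' : (0 : ℝ) < n := by exact_mod_cast hn
  set L := Real.log (vmax / (e * μ))
  have hL2 : Real.log 2 ≤ L := log_div_ge he he' hμ hv
  have hL : 0.69 ≤ L := le_trans (by have := Real.log_two_gt_d9; norm_num at this ⊢; linarith) hL2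
  have e1 : vmax / firstCell n e μ = 2 ^ 5 * n ^ 2 * (vmax / (e * μ)) := by
    unfold firstCell lotteryProb; field_simp; ring
  have h1 : Real.log (vmax / firstCell n e μ) = 5 * Real.log 2 + 2 * Real.log n + L := by
    have hv' : 0 < vmax := hμ.trans_le hv
    rw [e1, Real.log_mul (by positivity) (by positivity), Real.log_mul (by positivity)
      (by positivity), Real.log_pow, Real.log_pow]
    push_cast; rfl
  have hℓL : L ≤ ℓ * L := le_mul_of_one_le_left (by linarith) hℓ
  have hℓL' : 2 * ℓ ≤ 3 * (ℓ * L) := by nlinarith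
  have h2 : Real.log (vmax / firstCell n e μ) ≤ 9 * (ℓ * L) := by rw [h1]; linarith
  have h0 : 0 ≤ Real.log (vmax / firstCell n e μ) := by
    rw [h1]
    have := Real.log_nonneg (show (1 : ℝ) ≤ n by exact_mod_cast hn)
    have := Real.log_nonneg one_le_two
    linarith
  have h3 : (⌈8 / e * Real.log (vmax / firstCell n e μ)⌉₊ : ℝ) <
      8 / e * Real.log (vmax / firstCell n e μ) + 1 := Nat.ceil_lt_add_one (by positivity)
  have h4 : 8 / e * Real.log (vmax / firstCell n e μ) ≤ 72 * (ℓ * L / e) := by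
    calc _ ≤ 8 / e * (9 * (ℓ * L)) := mul_le_mul_of_nonneg_left h2 (by positivity)
      _ = _ := by ring
  have h5 : 1 ≤ ℓ * L / e := by rw [le_div_iff₀ he]; linarith
  unfold numCells
  push_cast
  linarith

/-- Here `4 / η² = 16384 n² K² / e²`, and `2 / p = 128 n² K² / e` is crudely at most `f ^ 29`;
`475136 = 16384 * 29`. -/
theorem numTrials_le (hn : 1 ≤ n) (he : 0 < e) (he' : e ≤ 1 / 2) {f L ℓ : ℝ} (hf : 10 ≤ f)
    (hnf : n ≤ f) (hef : e⁻¹ ≤ f) (hLf : L ≤ f) (hL : 0 ≤ L) (hℓ : Real.log f = ℓ)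
    (hK : (numCells n e vmax μ : ℝ) ≤ 75 * (ℓ * L / e)) :
    (numTrials n e vmax μ : ℝ) ≤
      475136 * ((n : ℝ) ^ 2 * (numCells n e vmax μ : ℝ) ^ 2 / e ^ 2 * ℓ) + 2 := by
  have hn' : (1 : ℝ) ≤ n := by exact_mod_cast hn
  have hK2 := two_le_numCells (n := n) (e := e) (vmax := vmax) (μ := μ)
  have hη : 4 * ((accuracy n e vmax μ) ^ 2)⁻¹ =
      16384 * ((n : ℝ) ^ 2 * (numCells n e vmax μ : ℝ) ^ 2 / e ^ 2) := by
    unfold accuracy lotteryProb; field_simp; norm_num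
  have hp : 2 / failureProb n e vmax μ = 128 * ((n : ℝ) ^ 2 * (numCells n e vmax μ : ℝ) ^ 2 * e⁻¹) := by
    unfold failureProb lotteryProb; field_simp; norm_num
  set K := (numCells n e vmax μ : ℝ)
  have hℓf : ℓ ≤ f := by rw [← hℓ]; exact (Real.log_le_sub_one_of_pos (by linarith)).trans (by linarith)
  have hKf : K ≤ 75 * (f * f * f) := by
    refine hK.trans ?_
    rw [div_eq_mul_inv]
    gcongr
  have hΛ : Real.log (2 / failureProb n e vmax μ) ≤ 29 * ℓ := by
    rw [← hℓ, ← Nat.cast_ofNat (n := 29), ← Real.log_pow]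
    have hei : 0 < e⁻¹ := inv_pos.2 he
    refine Real.log_le_log (by rw [hp]; positivity) ?_
    rw [hp]
    have h1 : (720000 : ℝ) ≤ f ^ 20 := by
      calc (720000 : ℝ) ≤ 10 ^ 20 := by norm_num
        _ ≤ f ^ 20 := pow_le_pow_left₀ (by norm_num) hf 20
    calc 128 * ((n : ℝ) ^ 2 * K ^ 2 * e⁻¹) ≤ 128 * (f ^ 2 * (75 * (f * f * f)) ^ 2 * f) := by
          gcongr
      _ = 720000 * f ^ 9 := by ring
      _ ≤ f ^ 20 * f ^ 9 := mul_le_mul_of_nonneg_right h1 (by positivity)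
      _ = f ^ 29 := by ring
  have h0 : 0 ≤ Real.log (2 / failureProb n e vmax μ) := by
    refine Real.log_nonneg ?_
    rw [hp]
    have h1 : 1 ≤ e⁻¹ := by rw [one_le_inv₀ he]; linarith
    have h2 : 1 ≤ (n : ℝ) ^ 2 * K ^ 2 * e⁻¹ := one_le_mul_of_one_le_of_one_le
      (one_le_mul_of_one_le_of_one_le (one_le_pow₀ hn') (one_le_pow₀ (by linarith))) h1
    linarith
  unfold numTrials
  have h3 := Nat.ceil_lt_add_one (show 0 ≤ 4 * ((accuracy n e vmax μ) ^ 2)⁻¹ *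
    Real.log (2 / failureProb n e vmax μ) by positivity)
  have h4 := mul_le_mul_of_nonneg_left hΛ
    (show 0 ≤ 4 * ((accuracy n e vmax μ) ^ 2)⁻¹ by positivity)
  rw [hη] at h3 h4 ⊢
  push_cast
  linarith

theorem calls_le_runtimeScale (hn : 1 ≤ n) (he : 0 < e) (he' : e ≤ 1 / 2) (hμ : 0 < μ)
    (hv : μ ≤ vmax) :
    ((1 + n * (2 * numCells n e vmax μ) * numTrials n e vmax μ : ℕ) : ℝ) ≤
      3 * 475138 * 421875 * runtimeScale n e vmax μ * Real.log (runtimeScale n e vmax μ) ^ 4 := by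
  set L := Real.log (vmax / (e * μ))
  have hL : 0.69 ≤ L := le_trans (by have := Real.log_two_gt_d9; norm_num at this ⊢; linarith)
    (log_div_ge he he' hμ hv)
  obtain ⟨h10, hnf, hef, hLf⟩ := params_le_runtimeScale hn he he' hL
    (f := runtimeScale n e vmax μ) rfl
  set f := runtimeScale n e vmax μ
  have hℓ : 1 ≤ Real.log f := by
    rw [Real.le_log_iff_exp_le (by linarith)]
    have := Real.exp_one_lt_d9
    norm_num at this
    linarith
  have hn' : (1 : ℝ) ≤ n := by exact_mod_cast hn
  have hK2 := two_le_numCells (n := n) (e := e) (vmax := vmax) (μ := μ)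
  have hK := numCells_le (vmax := vmax) hn he he' hμ hv hℓ (Real.log_le_log (by linarith) hnf)
  have hs := numTrials_le (vmax := vmax) (μ := μ) hn he he' h10 hnf hef hLf (by linarith) rfl
    hK
  have := calls_le_of_params hn he he' hℓ (by linarith) hK hs
  push_cast
  exact this

end runtime

/-! ### Guarantees of the mechanism -/

section

variable {n : ℕ} {F : Fin n → Measure ℝ} {vmax : ℝ}

theorem one_le_of_maxMean_pos (h : 0 < maxMean F) : 1 ≤ n := by
  rcases Nat.eq_zero_or_pos n with rfl | hn
  · simp [maxMean] at h
  · exact hn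

theorem maxMean_le_sum (hF : ∀ i, ∀ᵐ x ∂(F i), x ∈ Set.Icc 0 vmax) (h : 0 < maxMean F) :
    maxMean F ≤ ∑ i, ∫ x, x ∂(F i) := by
  have : Nonempty (Fin n) := ⟨⟨0, one_le_of_maxMean_pos h⟩⟩
  refine ciSup_le fun i => ?_
  exact Finset.single_le_sum (f := fun i => ∫ x, x ∂(F i))
    (fun j _ => integral_nonneg_of_ae ((hF j).mono fun x hx => hx.1)) (Finset.mem_univ i)

variable [∀ i, IsProbabilityMeasure (F i)]

theorem integrable_of_ae_mem_Icc (hF : ∀ i, ∀ᵐ x ∂(F i), x ∈ Set.Icc 0 vmax) (i : Fin n) :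
    Integrable (fun x => x) (F i) :=
  Integrable.of_bound aestronglyMeasurable_id vmax ((hF i).mono fun x hx => by
    rw [Real.norm_eq_abs, abs_of_nonneg hx.1]; exact hx.2)

theorem maxMean_le (hF : ∀ i, ∀ᵐ x ∂(F i), x ∈ Set.Icc 0 vmax) (h : 0 < maxMean F) :
    maxMean F ≤ vmax := by
  have : Nonempty (Fin n) := ⟨⟨0, one_le_of_maxMean_pos h⟩⟩
  refine ciSup_le fun i => ?_
  have := integral_mono_ae (integrable_of_ae_mem_Icc hF i) (integrable_const vmax)
    ((hF i).mono fun x hx => hx.2)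
  simpa using this

/-- The guarantees of the mechanism, except for its running time. -/
theorem mechanism_spec {e : ℝ} (he : 0 < e) (he' : e ≤ 1 / 2)
    {feasible : Finset (Finset (Fin n))} (hdown : IsDownwardClosed feasible)
    (hsingle : ∀ i, {i} ∈ feasible) (hF : ∀ i, ∀ᵐ x ∂(F i), x ∈ Set.Icc 0 vmax)
    (hμ : 0 < maxMean F) {A : Algorithm n} (hA : A.IsFeasible feasible) :
    ((mechanism n e vmax (maxMean F)).algorithm F A).IsFeasible feasible ∧
      ((mechanism n e vmax (maxMean F)).algorithm F A).IsMonotone F vmax ∧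
      A.welfare F ≤ (1 + e) * ((mechanism n e vmax (maxMean F)).algorithm F A).welfare F := by
  have hn := one_le_of_maxMean_pos hμ
  have hn' : (1 : ℝ) ≤ n := by exact_mod_cast hn
  have hvμ := maxMean_le hF hμ
  have hsum := maxMean_le_sum hF hμ
  have hint := integrable_of_ae_mem_Icc hF
  have hpos : ∀ i, ∀ᵐ x ∂(F i), 0 ≤ x := fun i => (hF i).mono fun x hx => hx.1
  set μ := maxMean F
  have hw := lotteryProb_pos hn he
  have hwe := lotteryProb_le hn he
  have hK := two_le_numCells (n := n) (e := e) (vmax := vmax) (μ := μ)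
  have hη := accuracy_pos (vmax := vmax) (μ := μ) hn he
  have hp := failureProb_pos (vmax := vmax) (μ := μ) hn he
  have hexp := exp_numTrials_le (vmax := vmax) (μ := μ) hn he
  have ht := strictMono_geometricGrid (firstCell_pos hn he hμ) (show 1 < 1 + e / 4 by linarith)
  have hlast := lt_geometricGrid_numCells hn he he' (hμ.trans_le hvμ) hμ
  have htr (k : ℕ) : geometricGrid (firstCell n e μ) (1 + e / 4) (k + 2) ≤
      (1 + e / 4) * geometricGrid (firstCell n e μ) (1 + e / 4) (k + 1) := by
    simp only [geometricGrid]; exact le_of_eq (by ring)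
  have ht1 : n * geometricGrid (firstCell n e μ) (1 + e / 4) 1 = lotteryProb n e / 4 * μ := by
    simp only [geometricGrid, firstCell]; field_simp
  have hnw : n * lotteryProb n e = e / 8 := by unfold lotteryProb; field_simp
  have hslope1 : 2 * accuracy n e vmax μ * numCells n e vmax μ = lotteryProb n e / 4 := by
    unfold accuracy; field_simp; norm_num
  have hslope2 : n * (2 * numCells n e vmax μ) * failureProb n e vmax μ =
      lotteryProb n e / (4 * numCells n e vmax μ) := by
    unfold failureProb; field_simp; norm_num
  have hslope3 : 2 * accuracy n e vmax μ = lotteryProb n e / (4 * numCells n e vmax μ) := by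
    unfold accuracy; field_simp; norm_num
  have hη' : accuracy n e vmax μ ≤ 1 / 2 := by
    unfold accuracy
    rw [div_le_div_iff₀ (by positivity) two_pos]
    linarith
  have hp' : failureProb n e vmax μ ≤ 1 := by
    unfold failureProb
    refine div_le_one_of_le₀ ?_ (by positivity)
    have : 1 ≤ 8 * n * (numCells n e vmax μ : ℝ) ^ 2 :=
      one_le_mul_of_one_le_of_one_le (by linarith) (one_le_pow₀ (by linarith))
    linarith
  have hs : 0 < numTrials n e vmax μ := Nat.succ_pos _
  simp only [mechanism]
  set t := geometricGrid (firstCell n e μ) (1 + e / 4)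
  set K := numCells n e vmax μ
  set w := lotteryProb n e
  have ht0 : t 0 = 0 := rfl
  have hsupp : ∀ i, ∀ᵐ x ∂(F i), x ∈ Set.Ico (t 0) (t K) := fun i =>
    (hF i).mono fun x hx => ⟨hx.1, hx.2.trans_lt hlast⟩
  have hsmall : w / (4 * K) ≤ e / 32 := by
    rw [div_le_div_iff₀ (by positivity) (by norm_num)]
    nlinarith
  refine ⟨?_, fun i b _ b' hb' hbb => ?_, ?_⟩
  · have hempty : ∅ ∈ feasible := hdown _ (hsingle ⟨0, hn⟩) _ (Finset.empty_subset _)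
    exact isFeasible_lottery hempty hsingle hw.le (by linarith) cellWeight_nonneg
      cellWeight_le_one (denotes_estimateAndIron_self hsupp) (isFeasible_estimateAndIron hsupp hA) _
  · refine interim_reduction_mono ht ht0 hsupp hint hpos hs hη.le hη' hexp hp' hw.le
      (by linarith) (by exact_mod_cast (show (0 : ℝ) < K by linarith)) ?_ hbb
      ⟨hb'.1, hb'.2.trans_lt hlast⟩ i
    -- The two errors are `w / (4 * K)` each and together use up the slope `w / (2 * K)` exactly.
    rw [hslope2, hslope3]
    exact le_of_eq (by field_simp; norm_num)
  · refine welfare_le_welfare_reduction ht ht0 (show 1 ≤ 1 + e / 4 by linarith) htr hsupp hint hpos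
      hs hη.le (by linarith) hexp hp' hw.le (by linarith) hslope1.le ?_ he.le ?_
    · rw [ht1]
      exact mul_le_mul_of_nonneg_left hsum (by linarith)
    -- The losses are `e / 8` and at most `e / 32`, and `(1 + e) * (1 - 5 * e / 32) ≥ 1 + e / 4` for
    -- `e ≤ 1 / 2`.
    · rw [hslope2, hnw]
      nlinarith

end

end OracleMechanism

theorem mainTheorem2 :
    ∃ (C : ℝ) (d : ℕ)
      -- the reduction: a program for each `n`, `ε`, `v_max`, `μ_max`
      (R : ∀ n : ℕ, ℝ → ℝ → ℝ → OracleProgram n n),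
      ∀ (n : ℕ) (ε vmax : ℝ) (feasible : Finset (Finset (Fin n)))
        (F : Fin n → Measure ℝ) [∀ i, IsProbabilityMeasure (F i)],
        0 < ε →
        IsDownwardClosed feasible →
        (∀ i, {i} ∈ feasible) →
        (∀ i, ∀ᵐ x ∂(F i), x ∈ Set.Icc 0 vmax) →
        0 < maxMean F →
        -- running time
        (((R n ε vmax (maxMean F)).algCalls : ℝ) ≤
            C * runtimeScale n (min ε (1 / 2)) vmax (maxMean F) *
              Real.log (runtimeScale n (min ε (1 / 2)) vmax (maxMean F)) ^ d ∧
          ((R n ε vmax (maxMean F)).distCalls : ℝ) ≤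
            n * (C * runtimeScale n (min ε (1 / 2)) vmax (maxMean F) *
              Real.log (runtimeScale n (min ε (1 / 2)) vmax (maxMean F)) ^ d)) ∧
        -- incentive compatibility and approximation
        ∀ (A : Algorithm n) (β : ℝ), 0 < β →
          A.IsBayesianApprox feasible F β →
            ((R n ε vmax (maxMean F)).toAlgorithm F A).IsMonotone F vmax ∧
            ((R n ε vmax (maxMean F)).toAlgorithm F A).IsBIC F vmax ∧
            ((R n ε vmax (maxMean F)).toAlgorithm F A).IsBayesianApprox feasible F
              (β * (1 + ε)) := by
  -- Accuracy above `1 / 2` is capped there: a better approximation than requested is still valid,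
  -- and the parameter bounds need `e ≤ 1 / 2`.
  refine ⟨3 * 475138 * 421875, 4, fun n ε vmax μ => mechanism n (min ε (1 / 2)) vmax μ n id, ?_⟩
  intro n ε vmax feasible F _ hε hdown hsingle hF hμ
  have he : 0 < min ε (1 / 2) := lt_min hε (by norm_num)
  have he' : min ε (1 / 2) ≤ 1 / 2 := min_le_right _ _
  have hn := one_le_of_maxMean_pos hμ
  have hruntime := calls_le_runtimeScale hn he he' hμ (maxMean_le hF hμ)
  obtain ⟨hcalls, hdist⟩ := InputProgram.callsLE_reduction (n := n)
    (geometricGrid (firstCell n (min ε (1 / 2)) (maxMean F)) (1 + min ε (1 / 2) / 4))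
    (numCells n (min ε (1 / 2)) vmax (maxMean F)) (numTrials n (min ε (1 / 2)) vmax (maxMean F))
    (lotteryProb n (min ε (1 / 2))) n id
  refine ⟨⟨(Nat.cast_le.2 hcalls).trans hruntime, ?_⟩, fun A β hβ hA => ?_⟩
  · refine (Nat.cast_le.2 hdist).trans ?_
    rw [Nat.cast_mul]
    exact mul_le_mul_of_nonneg_left hruntime (Nat.cast_nonneg n)
  · obtain ⟨hfeas, hmono, hwelfare⟩ := mechanism_spec he he' hdown hsingle hF hμ hA.1
    refine ⟨hmono, hmono.isBIC, hfeas, ?_⟩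
    rw [← div_div, div_le_iff₀ (by linarith)]
    refine hA.2.trans (hwelfare.trans ?_)
    rw [mul_comm]
    refine mul_le_mul_of_nonneg_left (by linarith [min_le_left ε (1 / 2)]) ?_
    exact welfare_nonneg _ (integrable_of_ae_mem_Icc hF) fun i => (hF i).mono fun x hx => hx.1
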